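/- **Definitions.** On $\mathbb C^2$ let $\langle z,w\rangle=\frac{\sqrt{-1}}{4}(z_1\bar w_2-z_2\bar w_1)$; thus $\langle z,z\rangle$ is the signed area of the triangle with vertices $0,z_1,z_2$. Let $\mathbb G=2\mathbb Z[\sqrt{-1}]\oplus 2\mathbb Z[\sqrt{-1}]\subset\mathbb C^2$ and $\mathbb G^+=\{z\in\mathbb G:\langle z,z\rangle>0\}$. The group $\langle\sqrt{-1}\rangle\times\mathrm{SL}(2,\mathbb Z)$ acts on $\mathbb G^+$: $\sqrt{-1}$ acts by scalar multiplication and $\begin{pmatrix}a&b\\c&d\end{pmatrix}$ by $(z_1,z_2)\mapsto(az_1+bz_2,\,cz_1+dz_2)$. A quadrangulation of a closed connected oriented surface is a finite collection of oriented unit squares whose sides are glued in pairs, reversing the orientation of the sides, so that the resulting surface is connected (two squares may share several sides or vertices). The degree of a vertex is the number of corners of squares at it; a vertex is singular if its degree is not $4$. Two quadrangulations are isomorphic if there is an orientation-preserving isometry between them that sends vertices, edges and squares to vertices, edges and squares. Let $HG_{Gauss}([2]_4)$ be the set of isomorphism classes of quadrangulations of the sphere (Euler characteristic $2$) with exactly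 four singular vertices, each of degree $2$. **Theorem.** There is a bijection $$\mathbb G^+/\bigl(\langle\sqrt{-1}\rangle\times \mathrm{SL}(2,\mathbb Z)\bigr)\;\longrightarrow\; HG_{Gauss}([2]_4)$$ with the following properties for every $z=(z_1,z_2)\in\mathbb G^+$. The class of $z$ is sent to the class of the quadrangulation obtained by gluing from the triangle with vertices $0,z_1,z_2$: each of the three sides $[a,b]$ of the triangle is folded at its midpoint (each $w\in[a,b]$ is glued to $a+b-w$), and the squares of the quadrangulation come from the unit squares of the grid $\mathbb Z[\sqrt{-1}]$ in the plane of the triangle. The square-norm $\langle z,z\rangle$ is the number of squares of this quadrangulation. -/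

import Mathlib

/-! ### The lattice side -/

/-- The Hermitian form `⟨z, w⟩ = (√-1 / 4) (z₁ w̄₂ - z₂ w̄₁)` on `ℂ²`; its square-norm `⟨z, z⟩` is the
signed area of the triangle with vertices `0, z₁, z₂`. -/
noncomputable def areaForm (z w : ℂ × ℂ) : ℂ :=
  Complex.I / 4 * (z.1 * (starRingEnd ℂ) w.2 - z.2 * (starRingEnd ℂ) w.1)

/-- `2ℤ[i] ⊕ 2ℤ[i]`, inside `ℂ²`. -/
def gaussLattice : Set (ℂ × ℂ) :=
  {z | ∃ a b : GaussianInt, z = (2 * (a : ℂ), 2 * (b : ℂ))}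

/-- The elements of positive square-norm of the lattice (the square-norm is always real). -/
def gaussLatticePos : Set (ℂ × ℂ) :=
  {z | z ∈ gaussLattice ∧ 0 < (areaForm z z).re}

/-- `√-1` as an invertible complex number. -/
noncomputable def unitI : ℂˣ := Units.mk0 Complex.I Complex.I_ne_zero

/-- The group `⟨√-1⟩ × SL(2, ℤ)`. -/
abbrev CutGlueGroup : Type :=
  (Subgroup.zpowers unitI) × Matrix.SpecialLinearGroup (Fin 2) ℤ

/-- `(u, A)` sends the column vector `(z₁, z₂)` to `u • A (z₁, z₂)`. -/
noncomputable def cutGlue (g : CutGlueGroup) (z : ℂ × ℂ) : ℂ × ℂ :=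
  (((g.1 : ℂˣ) : ℂ) * ((g.2.1 0 0 : ℂ) * z.1 + (g.2.1 0 1 : ℂ) * z.2),
   ((g.1 : ℂˣ) : ℂ) * ((g.2.1 1 0 : ℂ) * z.1 + (g.2.1 1 1 : ℂ) * z.2))

theorem zpowers_unitI_gauss (u : Subgroup.zpowers unitI) :
    ∃ a : GaussianInt, ((u : ℂˣ) : ℂ) = (a : ℂ) := by
  obtain ⟨u, k, rfl⟩ := u
  have h4 : unitI ^ 4 = 1 := by
    ext; simp [unitI]
  have hk : unitI ^ k = unitI ^ (k % 4).toNat := by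
    conv_lhs => rw [← Int.emod_add_mul_ediv k 4]
    rw [zpow_add, zpow_mul]
    have : unitI ^ (4 : ℤ) = 1 := by exact_mod_cast h4
    rw [this, one_zpow, mul_one, ← zpow_natCast, Int.toNat_of_nonneg (by omega)]
  refine ⟨(⟨0, 1⟩ : GaussianInt) ^ (k % 4).toNat, ?_⟩
  have hI : ((⟨0, 1⟩ : GaussianInt) : ℂ) = Complex.I := by
    simp [GaussianInt.toComplex_def]
  simp only [hk, Units.val_pow_eq_pow_val, map_pow, hI]
  rfl

theorem zpowers_unitI_norm (u : Subgroup.zpowers unitI) :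
    ((u : ℂˣ) : ℂ) * (starRingEnd ℂ) ((u : ℂˣ) : ℂ) = 1 := by
  obtain ⟨u, k, rfl⟩ := u
  rw [Complex.mul_conj, Complex.normSq_eq_norm_sq]
  simp [unitI]

theorem areaForm_cutGlue (g : CutGlueGroup) (z : ℂ × ℂ) :
    areaForm (cutGlue g z) (cutGlue g z) = areaForm z z := by
  have hu := zpowers_unitI_norm g.1
  have hd : (g.2.1 0 0 : ℂ) * (g.2.1 1 1 : ℂ) - (g.2.1 0 1 : ℂ) * (g.2.1 1 0 : ℂ) = 1 := by
    have := g.2.2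
    rw [Matrix.det_fin_two] at this
    exact_mod_cast this
  simp only [areaForm, cutGlue, map_mul, map_add, map_intCast]
  linear_combination
    (Complex.I / 4 * (z.1 * (starRingEnd ℂ) z.2 - z.2 * (starRingEnd ℂ) z.1)) *
      (((g.1 : ℂˣ) : ℂ) * (starRingEnd ℂ) ((g.1 : ℂˣ) : ℂ) * hd + hu)

theorem cutGlue_mem (g : CutGlueGroup) {z : ℂ × ℂ} (hz : z ∈ gaussLatticePos) :
    cutGlue g z ∈ gaussLatticePos := by
  refine ⟨?_, by rw [areaForm_cutGlue]; exact hz.2⟩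
  obtain ⟨a, b, rfl⟩ := hz.1
  obtain ⟨v, hv⟩ := zpowers_unitI_gauss g.1
  refine ⟨v * (g.2.1 0 0 * a + g.2.1 0 1 * b), v * (g.2.1 1 0 * a + g.2.1 1 1 * b), ?_⟩
  simp only [cutGlue, hv, map_mul, map_add, map_intCast, Prod.mk.injEq]
  constructor <;> ring

/-- The action of `⟨√-1⟩ × SL(2, ℤ)` on the positive part of the lattice. -/
noncomputable instance cutGlueAction : MulAction CutGlueGroup gaussLatticePos where
  smul g z := ⟨cutGlue g z.1, cutGlue_mem g z.2⟩
  one_smul z := by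
    apply Subtype.ext
    change cutGlue 1 z.1 = z.1
    simp [cutGlue]
  mul_smul g h z := by
    apply Subtype.ext
    change cutGlue (g * h) z.1 = cutGlue g (cutGlue h z.1)
    simp only [cutGlue, Prod.fst_mul, Prod.snd_mul, Subgroup.coe_mul, Units.val_mul,
      Matrix.SpecialLinearGroup.coe_mul, Matrix.mul_apply, Fin.sum_univ_two, Int.cast_add,
      Int.cast_mul, Prod.mk.injEq]
    constructor <;> ring

/-! ### Quadrangulations -/

/-- A quadrangulation of a closed connected oriented surface, as a combinatorial map.
The darts are the sides of the quadrangles, each oriented so that its quadrangle lies on its left.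
`next d` is the side that follows `d` on the boundary of the quadrangle of `d`, and `opp d` is the
side (of a quadrangle) that is glued to `d`, with the orientation reversed. -/
structure Quadrangulation where
  Dart : Type
  [finite : Finite Dart]
  [nonempty : Nonempty Dart]
  next : Equiv.Perm Dart
  opp : Equiv.Perm Dart
  next_period : ∀ d, Function.minimalPeriod next d = 4
  opp_opp : ∀ d, opp (opp d) = d
  opp_ne : ∀ d, opp d ≠ d
  connected : ∀ d d', ∃ g ∈ Subgroup.closure {next, opp}, g d = d'

namespace Quadrangulation

variable (Q : Quadrangulation)

/-- The counterclockwise rotation about the origin of a dart. -/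
def rot : Equiv.Perm Q.Dart := Q.next⁻¹.trans Q.opp

/-- Vertices, edges and quadrangles are the cycles of `rot`, `opp` and `next`. -/
def Vertex : Type := Quotient (Equiv.Perm.SameCycle.setoid Q.rot)

def Edge : Type := Quotient (Equiv.Perm.SameCycle.setoid Q.opp)

def Face : Type := Quotient (Equiv.Perm.SameCycle.setoid Q.next)

/-- The origin of a dart. -/
def origin (d : Q.Dart) : Q.Vertex := Quotient.mk (Equiv.Perm.SameCycle.setoid Q.rot) d

/-- The number of (corners of) quadrangles at a vertex. -/
noncomputable def degree (v : Q.Vertex) : ℕ := Nat.card {d : Q.Dart // Q.origin d = v}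

noncomputable def eulerChar : ℤ := Nat.card Q.Vertex - Nat.card Q.Edge + Nat.card Q.Face

/-- A vertex is singular if its combinatorial curvature `4 - degree` is nonzero. -/
def IsSingular (v : Q.Vertex) : Prop := Q.degree v ≠ 4

/-- Isomorphism of quadrangulations (sending vertices, edges and quadrangles to vertices, edges and
quadrangles and preserving the orientation). -/
def Iso (Q R : Quadrangulation) : Prop :=
  ∃ e : Q.Dart ≃ R.Dart, (∀ d, e (Q.next d) = R.next (e d)) ∧ ∀ d, e (Q.opp d) = R.opp (e d)

end Quadrangulation

/-- Quadrangulations of the sphere with exactly four singular vertices, each of which is incident to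
two quadrangles. -/
def SphereQuad224 : Type 1 :=
  {Q : Quadrangulation // Q.eulerChar = 2 ∧ Nat.card {v : Q.Vertex // Q.IsSingular v} = 4 ∧
    ∀ v, Q.IsSingular v → Q.degree v = 2}

instance sphereQuadSetoid : Setoid SphereQuad224 where
  r Q R := Quadrangulation.Iso Q.1 R.1
  iseqv :=
    { refl := fun _ => ⟨Equiv.refl _, fun _ => rfl, fun _ => rfl⟩
      symm := by
        rintro Q R ⟨e, h1, h2⟩
        exact ⟨e.symm, fun d => e.injective (by simp [h1]), fun d => e.injective (by simp [h2])⟩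
      trans := by
        rintro Q R S ⟨e, h1, h2⟩ ⟨f, k1, k2⟩
        exact ⟨e.trans f, fun d => by simp [h1, k1], fun d => by simp [h2, k2]⟩ }

/-- The set of isomorphism classes of such quadrangulations. -/
def HGGauss224 : Type 1 := Quotient sphereQuadSetoid

/-! ### The surface of a quadrangulation, and gluing a triangle -/

/-- The closed unit square `[0,1] × [0,1]` in the complex plane. -/
def unitSquare : Set ℂ := {w | 0 ≤ w.re ∧ w.re ≤ 1 ∧ 0 ≤ w.im ∧ w.im ≤ 1}

namespace Quadrangulation

variable (Q : Quadrangulation)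

/-- The pair `(d, w)` stands for the point `w` of the quadrangle of `d`, which is drawn as the unit
square with `d` as its bottom side, from `0` to `1`. Drawing the same quadrangle with `next d` as
its bottom side changes coordinates by `w ↦ 1 + i w`. The side `d` is glued to the side `opp d`. -/
inductive Glue : Q.Dart × unitSquare → Q.Dart × unitSquare → Prop
  | turn (d : Q.Dart) (w w' : unitSquare) (h : (w' : ℂ) = 1 + Complex.I * w) :
      Glue (Q.next d, w) (d, w')
  | side (d : Q.Dart) (w w' : unitSquare) (h0 : (w : ℂ).im = 0) (h : (w' : ℂ) = 1 - w) :
      Glue (d, w) (Q.opp d, w')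

/-- The surface obtained from the unit squares of `Q` by gluing their sides. -/
def Surface : Type := Quot Q.Glue

end Quadrangulation

/-- The closed triangle with vertices `0, z₁, z₂`. -/
def triangle (z : ℂ × ℂ) : Set ℂ := convexHull ℝ {0, z.1, z.2}

/-- Each of the three sides `[a, b]` of the triangle is folded at its midpoint: `w` is glued to its
image under the half-turn about `(a + b) / 2`. -/
def SideFold (z : ℂ × ℂ) (w w' : ℂ) : Prop :=
  ∃ s ∈ ({(0, z.1), (z.1, z.2), (z.2, 0)} : Set (ℂ × ℂ)),
    w ∈ segment ℝ s.1 s.2 ∧ w' = s.1 + s.2 - w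

/-- `Q` is the quadrangulation obtained from the triangle `0, z₁, z₂`, with the squares cut out in it
by the grid of Gaussian integers, by folding its three sides: the surface of `Q` is the quotient of
the triangle by the folding, and the part of the triangle in a square of the grid (with lower left
corner `p`) is carried by translation into a square of `Q`. -/
def IsFolding (z : ℂ × ℂ) (Q : Quadrangulation) : Prop :=
  ∃ h : triangle z → Q.Surface,
    Function.Surjective h ∧
    (∀ w w' : triangle z, h w = h w' ↔ Relation.EqvGen (SideFold z) w w') ∧
    ∀ p : GaussianInt, ∃ d : Q.Dart, ∀ (w : triangle z) (u : unitSquare),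
      (w : ℂ) = (p : ℂ) + u → h w = Quot.mk Q.Glue (d, u)

/-! All degrees being 2 or 4, the rotation of darts about their origins satisfies `rot ^ 4 = 1`.
Together with `next ^ 4 = 1` and `(rot * next) ^ 2 = 1` these are the relations of the group of
rotations and translations of the square grid. So `forward` and `leftward` commute, the Gaussian
integers act on the darts by `shift`, and `rot` turns these translations by a quarter
(`rot_semiconj_shift`).

Take a dart at a singular vertex; `rot ^ 2` fixes it. The translations fixing it form a lattice `L`
of finite index. If some element of `L` were not divisible by 2, a side would be glued to itself or
a square would be its own half-turn; so `L` is even, and the quadrangulation is the grid modulo the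
maps `w ↦ ±w + l` with `l ∈ L` (`exists_iso_latticeQuad`). Conversely every even lattice of finite
index gives such a quadrangulation, whose singular vertices are the four classes of half the points
of `L` modulo `L`.

An isomorphism commutes with `shift`, so the stabiliser of a dart recovers `L`, up to multiplication
by `√-1` because the dart may point in either grid direction (`iso_latticeQuad_iff`). Positively
oriented bases `2a, 2b` of `L` form one orbit of `SL(2, ℤ)`, which gives the bijection. The triangle
`0, 2a, 2b` is half of a period parallelogram, hence a fundamental domain, and the half-turns of the
group identify its boundary points exactly by folding the sides (`eqvGen_sideFold_iff`). -/

namespace Quadrangulation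

/-! ### Counting darts along the cycles of a permutation -/

section Cycles

variable {α : Type*} [Finite α]

theorem card_cycle_fiber (σ : Equiv.Perm α) (d : α) :
    Nat.card {x : α // Quotient.mk (Equiv.Perm.SameCycle.setoid σ) x =
      Quotient.mk (Equiv.Perm.SameCycle.setoid σ) d} = Function.minimalPeriod σ d := by
  have := Fintype.ofFinite (MulAction.orbit (Subgroup.zpowers σ) d)
  have h := MulAction.minimalPeriod_eq_card (a := σ) (b := d)
  have h2 : Function.minimalPeriod σ d = Nat.card (MulAction.orbit (Subgroup.zpowers σ) d) := by
    rw [Nat.card_eq_fintype_card]; exact h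
  rw [h2]
  refine Nat.card_congr (Equiv.subtypeEquivRight fun x => ?_)
  rw [Quotient.eq]
  change σ.SameCycle x d ↔ _
  rw [Equiv.Perm.sameCycle_comm]
  constructor
  · rintro ⟨k, hk⟩
    exact ⟨⟨σ ^ k, k, rfl⟩, hk⟩
  · rintro ⟨⟨_, k, rfl⟩, hk⟩
    exact ⟨k, hk⟩

theorem card_eq_sum_fiber {β : Type*} [Fintype β] (f : α → β) :
    Nat.card α = ∑ b, Nat.card {x // f x = b} := by
  rw [← Nat.card_congr (Equiv.sigmaFiberEquiv f), Nat.card_sigma]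

theorem card_eq_mul_card_cycles (σ : Equiv.Perm α) (k : ℕ)
    (h : ∀ d, Function.minimalPeriod σ d = k) :
    Nat.card α = k * Nat.card (Quotient (Equiv.Perm.SameCycle.setoid σ)) := by
  have := Fintype.ofFinite (Quotient (Equiv.Perm.SameCycle.setoid σ))
  rw [card_eq_sum_fiber (Quotient.mk (Equiv.Perm.SameCycle.setoid σ)),
    Finset.sum_congr rfl (g := fun _ => k)]
  · simp [mul_comm]
  · intro b _
    induction b using Quotient.inductionOn with
    | h d => rw [card_cycle_fiber, h]

end Cycles

attribute [instance] Quadrangulation.finite Quadrangulation.nonempty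

variable (Q : Quadrangulation)

instance : Finite Q.Vertex := inferInstanceAs (Finite (Quotient _))

theorem rot_eq : Q.rot = Q.opp * Q.next⁻¹ := rfl

theorem next_pow_four : Q.next ^ 4 = 1 := by
  ext d
  have := Function.iterate_minimalPeriod (f := Q.next) (x := d)
  rw [Q.next_period] at this
  exact this

theorem next_sq_ne (d : Q.Dart) : (Q.next ^ 2) d ≠ d := by
  intro h
  have h' : Function.IsPeriodicPt Q.next 2 d := h
  have := h'.minimalPeriod_le (by norm_num)
  rw [Q.next_period] at this
  omega

theorem opp_mul_opp : Q.opp * Q.opp = 1 := Equiv.ext Q.opp_opp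

theorem degree_origin (d : Q.Dart) :
    Q.degree (Q.origin d) = Function.minimalPeriod Q.rot d := card_cycle_fiber Q.rot d

theorem card_dart_eq_faces : Nat.card Q.Dart = 4 * Nat.card Q.Face :=
  card_eq_mul_card_cycles Q.next 4 Q.next_period

theorem card_dart_eq_edges : Nat.card Q.Dart = 2 * Nat.card Q.Edge :=
  card_eq_mul_card_cycles Q.opp 2 fun d => Function.minimalPeriod_eq_prime (p := 2)
    (Q.opp_opp d) (Q.opp_ne d)

/-- If every degree is `4` or `2`, the number of vertices of degree `2` determines the Euler
characteristic. -/
theorem card_dart_add_singular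
    (h2 : ∀ v, Q.IsSingular v → Q.degree v = 2) :
    Nat.card Q.Dart + 2 * Nat.card {v : Q.Vertex // Q.IsSingular v} = 4 * Nat.card Q.Vertex := by
  classical
  have := Fintype.ofFinite Q.Vertex
  rw [card_eq_sum_fiber Q.origin, Nat.card_eq_fintype_card (α := Q.Vertex),
    Nat.card_eq_fintype_card, Fintype.card_subtype, Finset.card_filter, Finset.mul_sum,
    ← Finset.sum_add_distrib, ← Finset.card_univ, Finset.card_eq_sum_ones, Finset.mul_sum]
  refine Finset.sum_congr rfl fun v _ => ?_
  change Q.degree v + _ = _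
  split_ifs with hv
  · rw [h2 v hv]
    norm_num
  · rw [not_not.1 hv]
    norm_num

/-- With `D` darts, `F = D / 4`, `E = D / 2` and `V = D / 4 + 2`. The condition on the Euler
characteristic thus follows from the conditions on the degrees. -/
theorem eulerChar_eq_two (h2 : ∀ v, Q.IsSingular v → Q.degree v = 2)
    (h4 : Nat.card {v : Q.Vertex // Q.IsSingular v} = 4) : Q.eulerChar = 2 := by
  have h := Q.card_dart_add_singular h2
  have hf := Q.card_dart_eq_faces
  have he := Q.card_dart_eq_edges
  rw [h4] at h
  unfold eulerChar
  omega

/-! ### Rotation about vertices of degree 2 and 4 -/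

theorem rot_pow_four (h2 : ∀ v, Q.IsSingular v → Q.degree v = 2) : Q.rot ^ 4 = 1 := by
  ext d
  have h : Function.minimalPeriod Q.rot d ∣ 4 := by
    rw [← Q.degree_origin]
    by_cases hs : Q.IsSingular (Q.origin d)
    · rw [h2 _ hs]; norm_num
    · rw [not_not.1 hs]
  exact Function.isPeriodicPt_iff_minimalPeriod_dvd.2 h

theorem rot_ne (h2 : ∀ v, Q.IsSingular v → Q.degree v = 2) (d : Q.Dart) : Q.rot d ≠ d := by
  intro h
  have h1 : Function.minimalPeriod Q.rot d = 1 := Function.minimalPeriod_eq_one_iff_isFixedPt.2 h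
  rw [← Q.degree_origin] at h1
  by_cases hs : Q.IsSingular (Q.origin d)
  · rw [h2 _ hs] at h1; omega
  · rw [not_not.1 hs] at h1; omega

theorem isSingular_origin_iff (h4 : Q.rot ^ 4 = 1) (h1 : ∀ d, Q.rot d ≠ d) (d : Q.Dart) :
    Q.IsSingular (Q.origin d) ↔ (Q.rot ^ 2) d = d := by
  unfold IsSingular
  rw [Q.degree_origin]
  have hd : Function.minimalPeriod Q.rot d ∣ 4 :=
    Function.isPeriodicPt_iff_minimalPeriod_dvd.1 (Equiv.Perm.ext_iff.1 h4 d)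
  have hne : Function.minimalPeriod Q.rot d ≠ 1 := fun h =>
    h1 d (Function.minimalPeriod_eq_one_iff_isFixedPt.1 h)
  have h2 : (Q.rot ^ 2) d = d ↔ Function.minimalPeriod Q.rot d ∣ 2 :=
    Function.isPeriodicPt_iff_minimalPeriod_dvd (f := Q.rot)
  rw [h2]
  have hle := Nat.le_of_dvd (by norm_num) hd
  interval_cases Function.minimalPeriod Q.rot d <;> simp_all

/-- Step forward along the line of a dart. -/
def forward : Equiv.Perm Q.Dart := Q.rot⁻¹ * Q.next

/-- Step sideways to the left. -/
def leftward : Equiv.Perm Q.Dart := Q.rot⁻¹ * Q.forward * Q.rot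

/-- Translation of a dart by a Gaussian integer, in the frame of the dart. -/
def shift (p : GaussianInt) : Equiv.Perm Q.Dart := Q.leftward ^ p.im * Q.forward ^ p.re

theorem rot_mul_next : Q.rot * Q.next = Q.opp := by simp [rot_eq]

theorem next_eq : Q.next = Q.rot * Q.forward := by simp [forward]

theorem rot_mul_leftward : Q.rot * Q.leftward = Q.forward * Q.rot := by
  simp [leftward, mul_assoc]

theorem rot_sq_mul_forward : Q.rot ^ 2 * Q.forward = Q.opp := by
  rw [sq, mul_assoc, ← next_eq, rot_mul_next]

/-! ### The relations between rotations and translations -/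

variable {Q}

theorem rot_sq_inv (h4 : Q.rot ^ 4 = 1) : (Q.rot ^ 2)⁻¹ = Q.rot ^ 2 :=
  inv_eq_of_mul_eq_one_left (by rw [← pow_add]; exact h4)

theorem next_sq_inv : (Q.next ^ 2)⁻¹ = Q.next ^ 2 :=
  inv_eq_of_mul_eq_one_left (by rw [← pow_add]; exact Q.next_pow_four)

/-- `rot ^ 2 * forward = opp` is an involution and `rot ^ 2` is its own inverse, so `rot ^ 2`
inverts `forward`. -/
theorem rot_sq_semiconj_forward (h4 : Q.rot ^ 4 = 1) :
    SemiconjBy (Q.rot ^ 2) Q.forward Q.forward⁻¹ := by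
  have h : (Q.rot ^ 2 * Q.forward)⁻¹ = Q.rot ^ 2 * Q.forward := by
    rw [rot_sq_mul_forward, inv_eq_of_mul_eq_one_left Q.opp_mul_opp]
  rw [mul_inv_rev, rot_sq_inv h4] at h
  exact h.symm

theorem next_mul_rot : Q.next * Q.rot = Q.rot⁻¹ * Q.next⁻¹ := by
  have h := Q.opp_mul_opp
  rw [← rot_mul_next] at h
  rw [← mul_inv_rev, eq_inv_iff_mul_eq_one]
  have : Q.rot * (Q.next * Q.rot * (Q.next * Q.rot)) = Q.rot * 1 := by
    simp only [← mul_assoc] at h ⊢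
    rw [h, one_mul, mul_one]
  exact mul_left_cancel this

theorem leftward_eq (h4 : Q.rot ^ 4 = 1) : Q.leftward = Q.rot * Q.next⁻¹ := by
  have h : Q.rot⁻¹ * Q.rot⁻¹ * Q.rot⁻¹ = Q.rot := by
    rw [← mul_inv_rev, ← mul_inv_rev]
    exact inv_eq_of_mul_eq_one_left (by simpa [pow_succ, mul_assoc] using h4)
  rw [leftward, forward, mul_assoc, mul_assoc, next_mul_rot]
  simp only [← mul_assoc, h]

theorem forward_mul_leftward (h4 : Q.rot ^ 4 = 1) :
    Q.forward * Q.leftward = Q.rot ^ 2 * Q.next ^ 2 := by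
  rw [leftward_eq h4, forward, ← rot_sq_inv h4, ← next_sq_inv, sq, sq, mul_inv_rev, mul_inv_rev,
    mul_assoc, ← mul_assoc Q.next, next_mul_rot]
  simp only [mul_assoc]

/-- Going forward and left in either order is the diagonal move `rot ^ 2 * next ^ 2`; for the second
order this uses `next⁻¹ * rot⁻¹ = rot * next`, that is, `opp` being an involution. -/
theorem commute_forward_leftward (h4 : Q.rot ^ 4 = 1) : Commute Q.forward Q.leftward := by
  have h : Q.next⁻¹ * Q.rot⁻¹ = Q.rot * Q.next := by
    rw [← mul_inv_rev, rot_mul_next, inv_eq_of_mul_eq_one_left Q.opp_mul_opp]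
  change _ = _
  rw [forward_mul_leftward h4, leftward_eq h4, forward, mul_assoc, ← mul_assoc Q.next⁻¹, h, sq, sq]
  simp only [mul_assoc]

theorem rot_semiconj_forward (h4 : Q.rot ^ 4 = 1) :
    SemiconjBy Q.rot Q.forward Q.leftward⁻¹ := by
  have h := rot_sq_semiconj_forward h4
  have e : Q.leftward⁻¹ = Q.rot⁻¹ * Q.forward⁻¹ * Q.rot := by
    simp only [leftward, mul_inv_rev, inv_inv, mul_assoc]
  change _ = _
  rw [e, mul_assoc, mul_assoc, ← sq, ← h.eq, sq]
  simp only [mul_assoc, inv_mul_cancel_left]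

theorem shift_add (h4 : Q.rot ^ 4 = 1) (p q : GaussianInt) :
    Q.shift (p + q) = Q.shift p * Q.shift q := by
  have h := commute_forward_leftward h4
  simp only [shift, Zsqrtd.re_add, Zsqrtd.im_add, zpow_add]
  rw [mul_assoc, mul_assoc, ← mul_assoc (Q.leftward ^ q.im), ← mul_assoc (Q.forward ^ p.re),
    (h.zpow_zpow p.re q.im).eq]

variable (Q) in
@[simp] theorem shift_zero : Q.shift 0 = 1 := by simp [shift]

variable (Q) in
@[simp] theorem shift_one : Q.shift 1 = Q.forward := by simp [shift]

variable (Q) in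
@[simp] theorem shift_I : Q.shift ⟨0, 1⟩ = Q.leftward := by simp [shift]

theorem shift_neg (h4 : Q.rot ^ 4 = 1) (p : GaussianInt) : Q.shift (-p) = (Q.shift p)⁻¹ := by
  rw [eq_inv_iff_mul_eq_one, ← shift_add h4, neg_add_cancel, shift_zero]

/-- The frame of `rot d` is that of `d` turned by a quarter: the translation read as `√-1 * p` from
`d` is read as `p` from `rot d`. -/
theorem rot_semiconj_shift (h4 : Q.rot ^ 4 = 1) (p : GaussianInt) :
    SemiconjBy Q.rot (Q.shift (⟨0, 1⟩ * p)) (Q.shift p) := by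
  have hL : SemiconjBy Q.rot Q.leftward Q.forward := Q.rot_mul_leftward
  have h := (hL.zpow_right p.re).mul_right ((rot_semiconj_forward h4).zpow_right (-p.im))
  have e1 : Q.shift (⟨0, 1⟩ * p) = Q.leftward ^ p.re * Q.forward ^ (-p.im) := by
    simp [shift, Zsqrtd.re_mul, Zsqrtd.im_mul]
  rw [inv_zpow', neg_neg, ((commute_forward_leftward h4).zpow_zpow p.re p.im).eq] at h
  rw [e1]
  exact h

theorem rot_sq_semiconj_shift (h4 : Q.rot ^ 4 = 1) (p : GaussianInt) :
    SemiconjBy (Q.rot ^ 2) (Q.shift p) (Q.shift (-p)) := by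
  have h1 := rot_semiconj_shift h4 (⟨0, 1⟩ * -p)
  have h2 := rot_semiconj_shift h4 (-p)
  have e : (⟨0, 1⟩ * (⟨0, 1⟩ * -p) : GaussianInt) = p := by
    ext <;> simp
  rw [e] at h1
  rw [sq]
  exact h2.mul_left h1

end Quadrangulation

/-! ### The quadrangulation of a lattice -/

section LatticeQuad

variable (L : AddSubgroup GaussianInt)

/-- The grid darts modulo `w ↦ ±w + l`: `(p, false)` points from `p` to `p + 1` and `(p, true)`
points from `p` to `p + √-1`. -/
abbrev GridDart : Type := (GaussianInt ⧸ L) × Bool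

/-- The half-turns about half the points of `L` fix no edge and no square of the grid. -/
def IsEvenLattice : Prop := ∀ p ∈ L, ∃ q : GaussianInt, p = 2 * q

/-- A side pointing in direction `-1` or `-√-1` is replaced by its image under `w ↦ -w`. After `p →
p + √-1` comes the side from `p + √-1` in direction `-1`, whence the sign in the second case;
`gridOpp` follows the same rule. -/
def gridNext : Equiv.Perm (GridDart L) where
  toFun
    | (p, false) => (p + (1 : GaussianInt), true)
    | (p, true) => (-p - (⟨0, 1⟩ : GaussianInt), false)
  invFun
    | (p, true) => (p - (1 : GaussianInt), false)
    | (p, false) => (-p - (⟨0, 1⟩ : GaussianInt), true)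
  left_inv := by rintro ⟨p, _ | _⟩ <;> simp
  right_inv := by rintro ⟨p, _ | _⟩ <;> simp

def gridOpp : Equiv.Perm (GridDart L) :=
  Function.Involutive.toPerm
    (fun
      | (p, false) => (-p - (1 : GaussianInt), false)
      | (p, true) => (-p - (⟨0, 1⟩ : GaussianInt), true))
    (by rintro ⟨p, _ | _⟩ <;> simp)

variable {L}

theorem gridNext_false (p : GaussianInt ⧸ L) :
    gridNext L (p, false) = (p + (1 : GaussianInt), true) := rfl

theorem gridNext_true (p : GaussianInt ⧸ L) :
    gridNext L (p, true) = (-p - (⟨0, 1⟩ : GaussianInt), false) := rfl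

theorem gridOpp_false (p : GaussianInt ⧸ L) :
    gridOpp L (p, false) = (-p - (1 : GaussianInt), false) := rfl

theorem gridOpp_true (p : GaussianInt ⧸ L) :
    gridOpp L (p, true) = (-p - (⟨0, 1⟩ : GaussianInt), true) := rfl

/-- Equality would put `2 * p + r` in `L`, although one coordinate of `r` is odd. -/
theorem neg_sub_ne_of_even (hL : IsEvenLattice L) (p : GaussianInt ⧸ L) {r : GaussianInt}
    (hr : r.re % 2 = 1 ∨ r.im % 2 = 1) : -p - (r : GaussianInt ⧸ L) ≠ p := by
  induction p using QuotientAddGroup.induction_on with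
  | H p =>
    intro h
    rw [← QuotientAddGroup.mk_neg, ← QuotientAddGroup.mk_sub, QuotientAddGroup.eq] at h
    obtain ⟨q, hq⟩ := hL _ h
    have h1 := congrArg Zsqrtd.re hq
    have h2 := congrArg Zsqrtd.im hq
    simp at h1 h2
    omega

theorem gridNext_period (hL : IsEvenLattice L) (d : GridDart L) :
    Function.minimalPeriod (gridNext L) d = 4 := by
  -- The period is `2 ^ (1 + 1)` once `next ^ 2` moves `d` and `next ^ 4` fixes it.
  refine Function.minimalPeriod_eq_prime_pow (p := 2) (k := 1) ?_ ?_
  · change ¬ gridNext L (gridNext L d) = d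
    obtain ⟨p, _ | _⟩ := d
    · rw [gridNext_false, gridNext_true]
      intro h
      have h := congrArg Prod.fst h
      dsimp only at h
      rw [neg_add, sub_eq_add_neg, add_assoc, ← neg_add, ← sub_eq_add_neg,
        ← QuotientAddGroup.mk_add] at h
      exact neg_sub_ne_of_even hL p (by simp) h
    · rw [gridNext_true, gridNext_false]
      intro h
      have h := congrArg Prod.fst h
      dsimp only at h
      rw [sub_add, ← QuotientAddGroup.mk_sub] at h
      exact neg_sub_ne_of_even hL p (by simp) h
  · change gridNext L (gridNext L (gridNext L (gridNext L d))) = d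
    obtain ⟨p, _ | _⟩ := d <;> simp [gridNext_true, gridNext_false] <;> abel

theorem gridOpp_ne (hL : IsEvenLattice L) (d : GridDart L) : gridOpp L d ≠ d := by
  obtain ⟨p, _ | _⟩ := d
  · exact fun h => neg_sub_ne_of_even hL p (by simp) (congrArg Prod.fst h)
  · exact fun h => neg_sub_ne_of_even hL p (by simp) (congrArg Prod.fst h)

theorem grid_connected (d d' : GridDart L) :
    ∃ g ∈ Subgroup.closure {gridNext L, gridOpp L}, g d = d' := by
  set C := Subgroup.closure {gridNext L, gridOpp L} with hC
  have hN : gridNext L ∈ C := Subgroup.subset_closure (by simp)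
  have hO : gridOpp L ∈ C := Subgroup.subset_closure (by simp)
  have hR : gridOpp L * (gridNext L)⁻¹ ∈ C := C.mul_mem hO (C.inv_mem hN)
  have rf (p : GaussianInt ⧸ L) : (gridOpp L * (gridNext L)⁻¹) (p, false) = (p, true) := by
    change gridOpp L (-p - _, true) = _
    simp [gridOpp_true]
  have rt (p : GaussianInt ⧸ L) : (gridOpp L * (gridNext L)⁻¹) (p, true) = (-p, false) := by
    change gridOpp L (p - _, false) = _
    simp [gridOpp_false]
  suffices h : ∀ d, ∃ g ∈ C, g ((0 : GaussianInt ⧸ L), false) = d by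
    obtain ⟨g, hg, rfl⟩ := h d
    obtain ⟨k, hk, rfl⟩ := h d'
    exact ⟨k * g⁻¹, C.mul_mem hk (C.inv_mem hg), by simp⟩
  have step : ∀ {d} (k : Equiv.Perm (GridDart L)), k ∈ C →
      (∃ g ∈ C, g ((0 : GaussianInt ⧸ L), false) = d) →
      ∃ g ∈ C, g ((0 : GaussianInt ⧸ L), false) = k d := by
    rintro d k hk ⟨g, hg, rfl⟩
    exact ⟨k * g, C.mul_mem hk hg, rfl⟩
  -- Horizontal darts suffice, since `rot` reaches the vertical ones. The reachable points are
  -- closed under negation and under adding `1` and `√-1`, hence are all of them.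
  set A : GaussianInt → Prop := fun p =>
    ∃ g ∈ C, g ((0 : GaussianInt ⧸ L), false) = ((p : GaussianInt ⧸ L), false) with hA
  have neg : ∀ p, A p → A (-p) := by
    intro p hp
    have := step _ hR (step _ hR hp)
    rwa [rf, rt] at this
  have add1 : ∀ p, A p → A (p + 1) := by
    intro p hp
    have := step _ hR (step _ hN hp)
    rw [gridNext_false, rt] at this
    simpa using neg (-(p + 1)) this
  have addI : ∀ p, A p → A (p + ⟨0, 1⟩) := by
    intro p hp
    have := step _ hN (step _ hR hp)
    rw [rf, gridNext_true] at this
    have := neg (-p - ⟨0, 1⟩) (by simpa [hA] using this)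
    rwa [neg_sub, sub_neg_eq_add, add_comm] at this
  have sub1 : ∀ p, A p → A (p - 1) := by
    intro p hp
    have := neg _ (add1 _ (neg _ hp))
    rwa [neg_add, neg_neg, ← sub_eq_add_neg] at this
  have subI : ∀ p, A p → A (p - ⟨0, 1⟩) := by
    intro p hp
    have := neg _ (addI _ (neg _ hp))
    rwa [neg_add, neg_neg, ← sub_eq_add_neg] at this
  have hre : ∀ m : ℤ, A ⟨m, 0⟩ := by
    intro m
    induction m using Int.induction_on with
    | zero => exact ⟨1, C.one_mem, rfl⟩
    | succ m ih =>
      convert add1 _ ih using 1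
      ext <;> simp
    | pred m ih =>
      convert sub1 _ ih using 1
      ext <;> simp
  have him : ∀ m n : ℤ, A ⟨m, n⟩ := by
    intro m n
    induction n using Int.induction_on with
    | zero => exact hre m
    | succ n ih =>
      convert addI _ ih using 1
      ext <;> simp
    | pred n ih =>
      convert subI _ ih using 1
      ext <;> simp
  rintro ⟨p, _ | _⟩
  · induction p using QuotientAddGroup.induction_on with
    | H p => exact him p.re p.im
  · induction p using QuotientAddGroup.induction_on with
    | H p =>
      have := step _ hR (him p.re p.im)
      rwa [rf] at this

/-- The quotient of the grid of Gaussian integers by the group of the maps `w ↦ ±w + l`, `l ∈ L`. -/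
def latticeQuad (L : AddSubgroup GaussianInt) [Finite (GaussianInt ⧸ L)] (hL : IsEvenLattice L) :
    Quadrangulation where
  Dart := GridDart L
  next := gridNext L
  opp := gridOpp L
  next_period := gridNext_period hL
  opp_opp := by rintro ⟨p, _ | _⟩ <;> simp [gridOpp_true, gridOpp_false]
  opp_ne := gridOpp_ne hL
  connected := grid_connected

variable [Finite (GaussianInt ⧸ L)] (hL : IsEvenLattice L)

/-- The dart of `latticeQuad` at `p` in the direction `1` or `√-1`. -/
def latticeDart (p : GaussianInt ⧸ L) (b : Bool) : (latticeQuad L hL).Dart := (p, b)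

theorem latticeDart_surjective (d : (latticeQuad L hL).Dart) :
    ∃ (p : GaussianInt) (b : Bool), d = latticeDart hL p b := by
  obtain ⟨p, b⟩ := d
  induction p using QuotientAddGroup.induction_on with
  | H p => exact ⟨p, b, rfl⟩

theorem latticeDart_inj {p q : GaussianInt ⧸ L} {b c : Bool} :
    latticeDart hL p b = latticeDart hL q c ↔ p = q ∧ b = c := Prod.mk_inj

theorem latticeQuad_next_false (p : GaussianInt ⧸ L) :
    (latticeQuad L hL).next (latticeDart hL p false) =
      latticeDart hL (p + (1 : GaussianInt)) true := rfl

theorem latticeQuad_next_true (p : GaussianInt ⧸ L) :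
    (latticeQuad L hL).next (latticeDart hL p true) =
      latticeDart hL (-p - (⟨0, 1⟩ : GaussianInt)) false := rfl

theorem latticeQuad_opp_false (p : GaussianInt ⧸ L) :
    (latticeQuad L hL).opp (latticeDart hL p false) =
      latticeDart hL (-p - (1 : GaussianInt)) false := rfl

theorem latticeQuad_opp_true (p : GaussianInt ⧸ L) :
    (latticeQuad L hL).opp (latticeDart hL p true) =
      latticeDart hL (-p - (⟨0, 1⟩ : GaussianInt)) true := rfl

theorem latticeQuad_rot_false (p : GaussianInt ⧸ L) :
    (latticeQuad L hL).rot (latticeDart hL p false) = latticeDart hL p true := by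
  change (latticeQuad L hL).opp (latticeDart hL (-p - (⟨0, 1⟩ : GaussianInt)) true) = _
  rw [latticeQuad_opp_true]
  simp

theorem latticeQuad_rot_true (p : GaussianInt ⧸ L) :
    (latticeQuad L hL).rot (latticeDart hL p true) = latticeDart hL (-p) false := by
  change (latticeQuad L hL).opp (latticeDart hL (p - (1 : GaussianInt)) false) = _
  rw [latticeQuad_opp_false]
  simp

theorem latticeQuad_rot_sq (p : GaussianInt ⧸ L) (b : Bool) :
    ((latticeQuad L hL).rot ^ 2) (latticeDart hL p b) = latticeDart hL (-p) b := by
  rw [sq, Equiv.Perm.mul_apply]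
  cases b
  · rw [latticeQuad_rot_false, latticeQuad_rot_true]
  · rw [latticeQuad_rot_true, latticeQuad_rot_false]

theorem latticeQuad_rot_pow_four : (latticeQuad L hL).rot ^ 4 = 1 := by
  ext1 d
  obtain ⟨p, b, rfl⟩ := latticeDart_surjective hL d
  rw [show 4 = 2 + 2 from rfl, pow_add, Equiv.Perm.mul_apply, latticeQuad_rot_sq,
    latticeQuad_rot_sq, neg_neg, Equiv.Perm.one_apply]

theorem latticeQuad_rot_ne (d : (latticeQuad L hL).Dart) : (latticeQuad L hL).rot d ≠ d := by
  obtain ⟨p, _ | _, rfl⟩ := latticeDart_surjective hL d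
  · rw [latticeQuad_rot_false, Ne, latticeDart_inj]; simp
  · rw [latticeQuad_rot_true, Ne, latticeDart_inj]; simp

theorem latticeQuad_forward_false (p : GaussianInt ⧸ L) :
    (latticeQuad L hL).forward (latticeDart hL p false) =
      latticeDart hL (p + (1 : GaussianInt)) false := by
  rw [Quadrangulation.forward, Equiv.Perm.mul_apply, Equiv.Perm.inv_eq_iff_eq,
    latticeQuad_rot_false, latticeQuad_next_false]

theorem latticeQuad_leftward_false (p : GaussianInt ⧸ L) :
    (latticeQuad L hL).leftward (latticeDart hL p false) =
      latticeDart hL (p + (⟨0, 1⟩ : GaussianInt)) false := by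
  rw [Quadrangulation.leftward_eq (latticeQuad_rot_pow_four hL), Equiv.Perm.mul_apply]
  change (latticeQuad L hL).rot (latticeDart hL (-p - (⟨0, 1⟩ : GaussianInt)) true) = _
  rw [latticeQuad_rot_true]
  simp [add_comm]

theorem zpow_apply_of_translate {α K : Type*} [AddGroup K] (σ : Equiv.Perm α) (x : K → α) (a : K)
    (h : ∀ k, σ (x k) = x (k + a)) (n : ℤ) (k : K) : (σ ^ n) (x k) = x (k + n • a) := by
  induction n using Int.induction_on generalizing k with
  | zero => simp
  | succ n ih =>
    rw [zpow_add_one, Equiv.Perm.mul_apply, h, ih, add_comm (n : ℤ) 1, add_zsmul,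
      one_zsmul, add_assoc]
  | pred n ih =>
    have h' : σ⁻¹ (x k) = x (k - a) := by rw [Equiv.Perm.inv_eq_iff_eq, h, sub_add_cancel]
    rw [zpow_sub_one, Equiv.Perm.mul_apply, h', ih, sub_eq_add_neg (-(n : ℤ)) 1, add_comm _ (-1),
      add_zsmul, neg_one_zsmul, ← add_assoc, sub_eq_add_neg]

theorem latticeQuad_shift_false (p : GaussianInt ⧸ L) (q : GaussianInt) :
    (latticeQuad L hL).shift q (latticeDart hL p false) = latticeDart hL (p + q) false := by
  rw [Quadrangulation.shift, Equiv.Perm.mul_apply,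
    zpow_apply_of_translate _ (fun k => latticeDart hL k false) _ (latticeQuad_forward_false hL),
    zpow_apply_of_translate _ (fun k => latticeDart hL k false) _ (latticeQuad_leftward_false hL),
    add_assoc, ← QuotientAddGroup.mk_zsmul, ← QuotientAddGroup.mk_zsmul, ← QuotientAddGroup.mk_add]
  congr 3
  ext <;> simp

theorem latticeQuad_shift_true (p : GaussianInt ⧸ L) (q : GaussianInt) :
    (latticeQuad L hL).shift q (latticeDart hL p true) =
      latticeDart hL (p + (⟨0, 1⟩ * q : GaussianInt)) true := by
  have h := Quadrangulation.rot_semiconj_shift (latticeQuad_rot_pow_four hL) q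
  rw [← latticeQuad_rot_false hL, ← Equiv.Perm.mul_apply, ← h.eq, Equiv.Perm.mul_apply,
    latticeQuad_shift_false, latticeQuad_rot_false]

end LatticeQuad

/-! ### Every quadrangulation with degrees `2` and `4` comes from a lattice -/

namespace Quadrangulation

variable {Q : Quadrangulation} (h4 : Q.rot ^ 4 = 1) (d : Q.Dart)

/-- The translations that return to the dart `d`. -/
def periodLattice : AddSubgroup GaussianInt where
  carrier := {p | Q.shift p d = d}
  zero_mem' := by simp
  add_mem' := by
    intro p q hp hq
    change Q.shift (p + q) d = d
    rw [shift_add h4, Equiv.Perm.mul_apply, hq, hp]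
  neg_mem' := by
    intro p hp
    change Q.shift (-p) d = d
    rw [shift_neg h4, Equiv.Perm.inv_eq_iff_eq]
    exact hp.symm

theorem mem_periodLattice {p : GaussianInt} : p ∈ periodLattice h4 d ↔ Q.shift p d = d := Iff.rfl

theorem shift_eq_shift_iff (p q : GaussianInt) :
    Q.shift p d = Q.shift q d ↔ -p + q ∈ periodLattice h4 d := by
  rw [mem_periodLattice, shift_add h4, shift_neg h4, Equiv.Perm.mul_apply, Equiv.Perm.inv_eq_iff_eq,
    eq_comm]

variable {d}

/-- `rot ^ 2` fixes `d` and inverts translations, so it acts on the translates of `d` as the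
half-turn about its origin; now use `opp = rot ^ 2 * forward`. -/
theorem opp_shift (h4 : Q.rot ^ 4 = 1) (hd : (Q.rot ^ 2) d = d) (p : GaussianInt) :
    Q.opp (Q.shift p d) = Q.shift (-p - 1) d := by
  have h := rot_sq_semiconj_shift h4 (1 + p)
  rw [← rot_sq_mul_forward, Equiv.Perm.mul_apply, ← shift_one, ← Equiv.Perm.mul_apply (Q.shift 1),
    ← shift_add h4, ← Equiv.Perm.mul_apply, h.eq, Equiv.Perm.mul_apply, hd]
  congr 2; ring

theorem next_shift (h4 : Q.rot ^ 4 = 1) (p : GaussianInt) : Q.next (Q.shift p d) = Q.rot (Q.shift (p + 1) d) := by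
  rw [next_eq, Equiv.Perm.mul_apply, ← shift_one, ← Equiv.Perm.mul_apply (Q.shift 1),
    ← shift_add h4, add_comm]

theorem next_rot_shift (h4 : Q.rot ^ 4 = 1) (hd : (Q.rot ^ 2) d = d) (p : GaussianInt) :
    Q.next (Q.rot (Q.shift p d)) = Q.shift (-p - ⟨0, 1⟩) d := by
  have h := rot_sq_semiconj_shift h4 (⟨0, 1⟩ + p)
  rw [next_eq, Equiv.Perm.mul_apply, ← Equiv.Perm.mul_apply Q.forward, ← rot_mul_leftward,
    Equiv.Perm.mul_apply, ← Equiv.Perm.mul_apply Q.rot, ← sq, ← shift_I,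
    ← Equiv.Perm.mul_apply (Q.shift _), ← shift_add h4, ← Equiv.Perm.mul_apply, h.eq,
    Equiv.Perm.mul_apply, hd]
  congr 2; ring

theorem opp_rot_shift (h4 : Q.rot ^ 4 = 1) (hd : (Q.rot ^ 2) d = d) (p : GaussianInt) :
    Q.opp (Q.rot (Q.shift p d)) = Q.rot (Q.shift (-p - ⟨0, 1⟩) d) := by
  rw [← next_rot_shift h4 hd, ← Equiv.Perm.mul_apply Q.rot Q.next, rot_mul_next]

theorem rot_shift (h4 : Q.rot ^ 4 = 1) (p : GaussianInt) : Q.rot (Q.shift p d) = Q.shift (-⟨0, 1⟩ * p) (Q.rot d) := by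
  have h := rot_semiconj_shift h4 (-⟨0, 1⟩ * p)
  rw [← Equiv.Perm.mul_apply, ← Equiv.Perm.mul_apply, ← h.eq]
  congr 3
  ext <;> simp

theorem isEvenLattice_periodLattice (hd : (Q.rot ^ 2) d = d) :
    IsEvenLattice (periodLattice h4 d) := by
  have key : ∀ p r : GaussianInt, Q.shift p d ≠ Q.shift (-p - r) d → 2 * p + r ∉ periodLattice h4 d := by
    intro p r hne hmem
    refine hne ?_
    rw [shift_eq_shift_iff h4, ← neg_mem_iff]
    convert hmem using 1
    ring
  -- The three nonzero classes modulo 2 are excluded in turn: `1` and `√-1` would glue a side to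
  -- itself, and `1 + √-1` would make `next ^ 2` fix a dart.
  have k1 : ∀ p, 2 * p + 1 ∉ periodLattice h4 d := fun p => key p 1 fun h =>
    Q.opp_ne (Q.shift p d) (by rw [opp_shift h4 hd, ← h])
  have k2 : ∀ p, 2 * p + ⟨0, 1⟩ ∉ periodLattice h4 d := fun p => key p ⟨0, 1⟩ fun h =>
    Q.opp_ne (Q.rot (Q.shift p d)) (by rw [opp_rot_shift h4 hd, ← h])
  have k3 : ∀ p, 2 * p + (1 + ⟨0, 1⟩) ∉ periodLattice h4 d := fun p => key p _ fun h =>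
    Q.next_sq_ne (Q.shift p d) (by
      rw [sq, Equiv.Perm.mul_apply, next_shift h4, next_rot_shift h4 hd, h]
      congr 2; ring)
  intro l hl
  have e (r : GaussianInt) (h1 : l.re % 2 = r.re) (h2 : l.im % 2 = r.im) :
      l = 2 * ⟨l.re / 2, l.im / 2⟩ + r := by
    ext
    · simp; omega
    · simp; omega
  rcases Int.emod_two_eq_zero_or_one l.re with h1 | h1 <;>
    rcases Int.emod_two_eq_zero_or_one l.im with h2 | h2
  · exact ⟨_, (e 0 h1 h2).trans (add_zero _)⟩
  · exact (k2 _ (e ⟨0, 1⟩ h1 h2 ▸ hl)).elim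
  · exact (k1 _ (e 1 h1 h2 ▸ hl)).elim
  · exact (k3 _ (e (1 + (⟨0, 1⟩ : GaussianInt)) (by simp [h1]) (by simp [h2]) ▸ hl)).elim

/-- A quarter turn cannot preserve the dart `d`. -/
theorem shift_ne_rot_shift (h4 : Q.rot ^ 4 = 1) (h1 : ∀ d, Q.rot d ≠ d) (hd : (Q.rot ^ 2) d = d) (p q : GaussianInt) :
    Q.shift p d ≠ Q.rot (Q.shift q d) := by
  intro h
  have hr : Q.rot d = Q.shift (⟨0, 1⟩ * q + p) d := by
    rw [rot_shift h4, ← Equiv.Perm.inv_eq_iff_eq, ← shift_neg h4, ← Equiv.Perm.mul_apply,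
      ← shift_add h4] at h
    rw [← h]
    congr 2; ring
  set t : GaussianInt := ⟨0, 1⟩ * q + p
  have h2 : (1 - ⟨0, 1⟩) * t ∈ periodLattice h4 d := by
    rw [mem_periodLattice]
    conv_rhs => rw [← hd, sq, Equiv.Perm.mul_apply, hr, rot_shift h4, hr, ← Equiv.Perm.mul_apply,
      ← shift_add h4]
    congr 2; ring
  -- Evenness gives `(1 - √-1) * t = 2 * s`, that is `t = (1 + √-1) * s`. Then `s` is the centre of
  -- the quarter turn, so `rot` fixes the dart at `s`, which is impossible.
  obtain ⟨s, hs⟩ := isEvenLattice_periodLattice h4 hd _ h2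
  refine h1 (Q.shift s d) ?_
  rw [rot_shift h4, hr, ← Equiv.Perm.mul_apply, ← shift_add h4]
  congr 2
  have e1 := congrArg Zsqrtd.re hs
  have e2 := congrArg Zsqrtd.im hs
  simp at e1 e2
  ext
  · simp; omega
  · simp; omega

/-- The dart reached from `d` by a translation, well defined modulo `periodLattice`. -/
def foot (d : Q.Dart) (k : GaussianInt ⧸ periodLattice h4 d) : Q.Dart :=
  Quotient.liftOn' k (fun p => Q.shift p d) fun p q h => by
    rw [QuotientAddGroup.leftRel_apply] at h
    exact (shift_eq_shift_iff h4 d p q).2 h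

theorem foot_mk (p : GaussianInt) : foot h4 d p = Q.shift p d := rfl

theorem foot_injective : Function.Injective (foot h4 d) := by
  intro p q h
  induction p using QuotientAddGroup.induction_on with
  | H p =>
    induction q using QuotientAddGroup.induction_on with
    | H q =>
      rw [foot_mk, foot_mk, shift_eq_shift_iff h4] at h
      exact QuotientAddGroup.eq.2 h

theorem finite_quotient_periodLattice : Finite (GaussianInt ⧸ periodLattice h4 d) :=
  Finite.of_injective _ (foot_injective h4)

theorem exists_iso_latticeQuad (h1 : ∀ d, Q.rot d ≠ d) (hd : (Q.rot ^ 2) d = d) :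
    ∃ (_ : Finite (GaussianInt ⧸ periodLattice h4 d)) (hL : IsEvenLattice (periodLattice h4 d)),
      Iso (latticeQuad (periodLattice h4 d) hL) Q := by
  have hfin := finite_quotient_periodLattice h4 (d := d)
  have hL := isEvenLattice_periodLattice h4 hd
  refine ⟨hfin, hL, ?_⟩
  let f : (latticeQuad (periodLattice h4 d) hL).Dart → Q.Dart := fun x =>
    bif x.2 then Q.rot (foot h4 d x.1) else foot h4 d x.1
  have ff (p : GaussianInt) : f (latticeDart hL p false) = Q.shift p d := rfl
  have ft (p : GaussianInt) : f (latticeDart hL p true) = Q.rot (Q.shift p d) := rfl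
  have hn : ∀ x, f ((latticeQuad _ hL).next x) = Q.next (f x) := by
    intro x
    obtain ⟨p, _ | _, rfl⟩ := latticeDart_surjective hL x
    · rw [latticeQuad_next_false, ← QuotientAddGroup.mk_add, ft, ff, next_shift h4]
    · rw [latticeQuad_next_true, ← QuotientAddGroup.mk_neg, ← QuotientAddGroup.mk_sub, ft, ff,
        next_rot_shift h4 hd]
  have ho : ∀ x, f ((latticeQuad _ hL).opp x) = Q.opp (f x) := by
    intro x
    obtain ⟨p, _ | _, rfl⟩ := latticeDart_surjective hL x
    · rw [latticeQuad_opp_false, ← QuotientAddGroup.mk_neg, ← QuotientAddGroup.mk_sub, ff, ff,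
        opp_shift h4 hd]
    · rw [latticeQuad_opp_true, ← QuotientAddGroup.mk_neg, ← QuotientAddGroup.mk_sub, ft, ft,
        opp_rot_shift h4 hd]
  have hinj : Function.Injective f := by
    intro x y hxy
    obtain ⟨p, b, rfl⟩ := latticeDart_surjective hL x
    obtain ⟨q, c, rfl⟩ := latticeDart_surjective hL y
    cases b <;> cases c
    · exact congrArg (latticeDart hL · false) (foot_injective h4 hxy)
    · exact (shift_ne_rot_shift h4 h1 hd p q hxy).elim
    · exact (shift_ne_rot_shift h4 h1 hd q p hxy.symm).elim
    · exact congrArg (latticeDart hL · true) (foot_injective h4 (Q.rot.injective hxy))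
  -- The range of `f` is stable under `next` and `opp`, so connectedness makes it everything.
  have hsurj : Function.Surjective f := by
    intro y
    obtain ⟨g, hg, rfl⟩ := Q.connected (f (latticeDart hL 0 false)) y
    generalize latticeDart hL 0 false = x
    induction hg using Subgroup.closure_induction generalizing x with
    | mem g hg =>
      rcases hg with rfl | rfl
      · exact ⟨_, hn x⟩
      · exact ⟨_, ho x⟩
    | one => exact ⟨x, rfl⟩
    | mul g k _ _ hg hk =>
      obtain ⟨y, hy⟩ := hk x
      obtain ⟨z, hz⟩ := hg y
      exact ⟨z, by rw [hz, hy, Equiv.Perm.mul_apply]⟩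
    | inv g _ hg =>
      -- An injective map of a finite set into itself is onto, so stability under `g` gives
      -- stability under its inverse.
      have hsub : Set.MapsTo g (Set.range f) (Set.range f) := by
        rintro _ ⟨x, rfl⟩
        exact hg x
      obtain ⟨_, ⟨y, rfl⟩, hy⟩ :=
        ((Set.toFinite (Set.range f)).injOn_iff_bijOn_of_mapsTo hsub).1 g.injective.injOn |>.surjOn
          ⟨x, rfl⟩
      exact ⟨y, by rw [Equiv.Perm.eq_inv_iff_eq, hy]⟩
  exact ⟨Equiv.ofBijective f ⟨hinj, hsurj⟩, hn, ho⟩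

end Quadrangulation

/-! ### The lattice spanned by two Gaussian integers -/

/-- The lattice spanned by `2a` and `2b`. -/
def spanTwo (a b : GaussianInt) : AddSubgroup GaussianInt where
  carrier := {p | ∃ m n : ℤ, p = 2 * (m * a + n * b)}
  zero_mem' := ⟨0, 0, by simp⟩
  add_mem' := by
    rintro _ _ ⟨m, n, rfl⟩ ⟨k, l, rfl⟩
    exact ⟨m + k, n + l, by push_cast; ring⟩
  neg_mem' := by
    rintro _ ⟨m, n, rfl⟩
    exact ⟨-m, -n, by push_cast; ring⟩

theorem mem_spanTwo {a b p : GaussianInt} :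
    p ∈ spanTwo a b ↔ ∃ m n : ℤ, p = 2 * (m * a + n * b) := Iff.rfl

theorem isEvenLattice_spanTwo (a b : GaussianInt) : IsEvenLattice (spanTwo a b) := by
  rintro _ ⟨m, n, rfl⟩
  exact ⟨_, rfl⟩

/-- The oriented area of the parallelogram spanned by two Gaussian integers. -/
def gaussDet (a b : GaussianInt) : ℤ := a.re * b.im - a.im * b.re

theorem eq_zero_of_comb_eq_zero {a b : GaussianInt} (h : gaussDet a b ≠ 0) {m n : ℤ}
    (hmn : (m * a + n * b : GaussianInt) = 0) : m = 0 ∧ n = 0 := by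
  have h1 := congrArg Zsqrtd.re hmn
  have h2 := congrArg Zsqrtd.im hmn
  simp at h1 h2
  constructor
  · refine (mul_eq_zero.1 (?_ : m * gaussDet a b = 0)).resolve_right h
    unfold gaussDet
    linear_combination b.im * h1 - b.re * h2
  · refine (mul_eq_zero.1 (?_ : n * gaussDet a b = 0)).resolve_right h
    unfold gaussDet
    linear_combination a.re * h2 - a.im * h1

noncomputable def gaussBasis : Module.Basis (Fin 2) ℤ GaussianInt :=
  Module.Basis.ofEquivFun
    { toFun := fun p => ![p.re, p.im]
      invFun := fun c => ⟨c 0, c 1⟩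
      map_add' := by intro p q; ext i; fin_cases i <;> simp
      map_smul' := by intro p q; ext i; fin_cases i <;> simp
      left_inv := fun p => by ext <;> simp
      right_inv := fun c => by ext i; fin_cases i <;> simp }

theorem gaussBasis_det (v : Fin 2 → GaussianInt) :
    gaussBasis.det v = gaussDet (v 0) (v 1) := by
  rw [Module.Basis.det_apply, Matrix.det_fin_two]
  simp [Module.Basis.toMatrix_apply, gaussBasis, gaussDet]
  ring

noncomputable def spanTwoBasis {a b : GaussianInt} (h : gaussDet a b ≠ 0) :
    Module.Basis (Fin 2) ℤ (spanTwo a b) :=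
  Module.Basis.ofEquivFun (LinearEquiv.ofBijective
    ({ toFun := fun c => ⟨2 * (c 0 * a + c 1 * b), c 0, c 1, rfl⟩
       map_add' := by intro c e; ext1; simp; ring
       map_smul' := by intro c e; ext1; simp; ring } : (Fin 2 → ℤ) →ₗ[ℤ] spanTwo a b)
    ⟨by
      rw [injective_iff_map_eq_zero]
      intro c hc
      have hc := congrArg Subtype.val hc
      have := eq_zero_of_comb_eq_zero h ((mul_eq_zero.1 hc).resolve_left two_ne_zero)
      ext i; fin_cases i
      exacts [this.1, this.2],
     by
      rintro ⟨_, m, n, rfl⟩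
      exact ⟨![m, n], by ext1; simp⟩⟩).symm

theorem coe_spanTwoBasis {a b : GaussianInt} (h : gaussDet a b ≠ 0) :
    ((spanTwoBasis h 0 : GaussianInt) = 2 * a) ∧ ((spanTwoBasis h 1 : GaussianInt) = 2 * b) := by
  constructor
  · simp only [spanTwoBasis, Module.Basis.coe_ofEquivFun, LinearEquiv.symm_symm]
    change (2 * ((Pi.single 0 1 : Fin 2 → ℤ) 0 * a + (Pi.single 0 1 : Fin 2 → ℤ) 1 * b)
      : GaussianInt) = _
    simp
  · simp only [spanTwoBasis, Module.Basis.coe_ofEquivFun, LinearEquiv.symm_symm]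
    change (2 * ((Pi.single 1 1 : Fin 2 → ℤ) 0 * a + (Pi.single 1 1 : Fin 2 → ℤ) 1 * b)
      : GaussianInt) = _
    simp

theorem index_spanTwo {a b : GaussianInt} (h : gaussDet a b ≠ 0) :
    (spanTwo a b).index = 4 * (gaussDet a b).natAbs := by
  rw [AddSubgroup.index_eq_natAbs_det gaussBasis _ (spanTwoBasis h), gaussBasis_det,
    (coe_spanTwoBasis h).1, (coe_spanTwoBasis h).2]
  have : gaussDet (2 * a) (2 * b) = 4 * gaussDet a b := by
    simp [gaussDet]; ring
  rw [this, Int.natAbs_mul]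
  rfl

theorem finite_quotient_spanTwo {a b : GaussianInt} (h : gaussDet a b ≠ 0) :
    Finite (GaussianInt ⧸ spanTwo a b) := by
  refine Nat.finite_of_card_ne_zero (α := GaussianInt ⧸ spanTwo a b) ?_
  change (spanTwo a b).index ≠ 0
  rw [index_spanTwo h]
  have := Int.natAbs_ne_zero.2 h
  omega

/-- Finite index forces rank 2, and evenness lets both basis vectors be halved. The determinant is
nonzero because the index is. -/
theorem exists_eq_spanTwo (L : AddSubgroup GaussianInt) [Finite (GaussianInt ⧸ L)]
    (hL : IsEvenLattice L) : ∃ a b : GaussianInt, 0 < gaussDet a b ∧ L = spanTwo a b := by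
  have : Module.Free ℤ GaussianInt := Module.Free.of_basis gaussBasis
  have : Module.Finite ℤ GaussianInt := Module.Finite.of_basis gaussBasis
  have hrank : Module.finrank ℤ L.toIntSubmodule = 2 := by
    rw [(Submodule.finiteQuotient_iff L.toIntSubmodule).1 ‹_›,
      Module.finrank_eq_card_basis gaussBasis, Fintype.card_fin]
  let c : Module.Basis (Fin 2) ℤ L := Module.finBasisOfFinrankEq ℤ L.toIntSubmodule hrank
  obtain ⟨a, ha⟩ := hL _ (c 0).2
  obtain ⟨b, hb⟩ := hL _ (c 1).2
  have hind : L.index ≠ 0 := (Nat.card_pos (α := GaussianInt ⧸ L)).ne'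
  rw [AddSubgroup.index_eq_natAbs_det gaussBasis L c, gaussBasis_det, ha, hb,
    Int.natAbs_ne_zero] at hind
  have hdet : gaussDet (2 * a) (2 * b) = 4 * gaussDet a b := by
    simp [gaussDet]; ring
  rw [hdet] at hind
  have hspan : L = spanTwo a b := by
    ext p
    rw [mem_spanTwo]
    constructor
    · intro hp
      have := congrArg Subtype.val (c.sum_repr ⟨p, hp⟩)
      rw [Fin.sum_univ_two] at this
      refine ⟨c.repr ⟨p, hp⟩ 0, c.repr ⟨p, hp⟩ 1, this.symm.trans ?_⟩
      simp [ha, hb]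
      ring
    · rintro ⟨m, n, rfl⟩
      have h0 := L.zsmul_mem (ha ▸ (c 0).2 : 2 * a ∈ L) m
      have h1 := L.zsmul_mem (hb ▸ (c 1).2 : 2 * b ∈ L) n
      convert L.add_mem h0 h1 using 1
      simp; ring
  -- Exchanging the two basis vectors makes the orientation positive.
  rcases lt_or_gt_of_ne (show gaussDet a b ≠ 0 by rintro h; simp [h] at hind) with h | h
  · refine ⟨b, a, by unfold gaussDet at h ⊢; linarith, ?_⟩
    rw [hspan]
    ext p
    rw [mem_spanTwo, mem_spanTwo]
    constructor <;> rintro ⟨m, n, rfl⟩ <;> exact ⟨n, m, by ring⟩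
  · exact ⟨a, b, h, hspan⟩

/-! ### The singular vertices of the quadrangulation of a lattice -/

theorem card_dart_latticeQuad (L : AddSubgroup GaussianInt) [Finite (GaussianInt ⧸ L)]
    (hL : IsEvenLattice L) : Nat.card (latticeQuad L hL).Dart = 2 * L.index := by
  change Nat.card ((GaussianInt ⧸ L) × Bool) = _
  rw [Nat.card_prod, Nat.card_eq_fintype_card (α := Bool), Fintype.card_bool, mul_comm]
  rfl

section

variable {L : AddSubgroup GaussianInt} [Finite (GaussianInt ⧸ L)] (hL : IsEvenLattice L)

theorem origin_rot (Q : Quadrangulation) (d : Q.Dart) : Q.origin (Q.rot d) = Q.origin d :=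
  Quotient.sound (Equiv.Perm.sameCycle_apply_left.2 (Equiv.Perm.SameCycle.refl _ _))

theorem exists_origin_eq (v : (latticeQuad L hL).Vertex) :
    ∃ p : GaussianInt, (latticeQuad L hL).origin (latticeDart hL p false) = v := by
  induction v using Quotient.inductionOn with
  | h d =>
    obtain ⟨p, _ | _, rfl⟩ := latticeDart_surjective hL d
    · exact ⟨p, rfl⟩
    · refine ⟨p, ?_⟩
      rw [← origin_rot, latticeQuad_rot_false]
      rfl

/-- Each rotation either keeps the base point or negates it, so a vertex is a point of the quotient
up to sign. -/
theorem eq_or_eq_neg_of_origin_eq {p q : GaussianInt ⧸ L}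
    (h : (latticeQuad L hL).origin (latticeDart hL p false) =
      (latticeQuad L hL).origin (latticeDart hL q false)) : q = p ∨ q = -p := by
  have h : (latticeQuad L hL).rot.SameCycle (latticeDart hL p false) (latticeDart hL q false) :=
    Quotient.exact h
  obtain ⟨k, hk⟩ := h.exists_nat_pow_eq
  have key : ∀ k : ℕ, ∃ (r : GaussianInt ⧸ L) (b : Bool), ((latticeQuad L hL).rot ^ k)
      (latticeDart hL p false) = latticeDart hL r b ∧ (r = p ∨ r = -p) := by
    intro k
    induction k with
    | zero => exact ⟨p, false, rfl, Or.inl rfl⟩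
    | succ k ih =>
      obtain ⟨r, b, h1, h2⟩ := ih
      rw [pow_succ', Equiv.Perm.mul_apply, h1]
      cases b
      · exact ⟨r, true, latticeQuad_rot_false hL r, h2⟩
      · refine ⟨-r, false, latticeQuad_rot_true hL r, ?_⟩
        rcases h2 with rfl | rfl <;> simp
  obtain ⟨r, b, h1, h2⟩ := key k
  rw [hk, latticeDart_inj] at h1
  rwa [h1.1]

theorem latticeQuad_isSingular_iff (p : GaussianInt) :
    (latticeQuad L hL).IsSingular ((latticeQuad L hL).origin (latticeDart hL p false)) ↔
      2 * p ∈ L := by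
  rw [Quadrangulation.isSingular_origin_iff _ (latticeQuad_rot_pow_four hL)
    (latticeQuad_rot_ne hL), latticeQuad_rot_sq, latticeDart_inj, ← QuotientAddGroup.mk_neg,
    QuotientAddGroup.eq, neg_neg, two_mul]
  simp

theorem latticeQuad_degree (v : (latticeQuad L hL).Vertex)
    (hv : (latticeQuad L hL).IsSingular v) : (latticeQuad L hL).degree v = 2 := by
  obtain ⟨p, rfl⟩ := exists_origin_eq hL v
  have h := (Quadrangulation.isSingular_origin_iff _ (latticeQuad_rot_pow_four hL)
    (latticeQuad_rot_ne hL) _).1 hv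
  rw [Quadrangulation.degree_origin]
  exact Function.minimalPeriod_eq_prime (p := 2) h (latticeQuad_rot_ne hL _)

end

/-- The singular vertices are the classes of `0`, `a`, `b`, `a + b`. They stay distinct up to sign
because a sign does not change the parities of the coefficients. -/
theorem card_singular_latticeQuad_spanTwo {a b : GaussianInt} (h : gaussDet a b ≠ 0)
    [Finite (GaussianInt ⧸ spanTwo a b)] (hL : IsEvenLattice (spanTwo a b)) :
    Nat.card {v // (latticeQuad (spanTwo a b) hL).IsSingular v} = 4 := by
  let f : Fin 2 × Fin 2 → {v // (latticeQuad (spanTwo a b) hL).IsSingular v} := fun s =>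
    ⟨(latticeQuad (spanTwo a b) hL).origin (latticeDart hL
      (((((s.1 : ℕ) : ℤ) * a + ((s.2 : ℕ) : ℤ) * b : GaussianInt))) false),
      (latticeQuad_isSingular_iff hL _).2 ⟨_, _, rfl⟩⟩
  have hf : Function.Bijective f := by
    constructor
    · rintro ⟨s, t⟩ ⟨s', t'⟩ hst
      have key : ∀ ε : ℤ, (ε = 1 ∨ ε = -1) →
          (((s' : ℕ) : ℤ) * a + ((t' : ℕ) : ℤ) * b -
            ε * (((s : ℕ) : ℤ) * a + ((t : ℕ) : ℤ) * b) : GaussianInt) ∈ spanTwo a b →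
          s = s' ∧ t = t' := by
        rintro ε hε ⟨m, n, hmn⟩
        have h0 : (((s' : ℕ) - ε * (s : ℕ) - 2 * m : ℤ) * a +
            ((t' : ℕ) - ε * (t : ℕ) - 2 * n : ℤ) * b : GaussianInt) = 0 := by
          push_cast at hmn ⊢
          linear_combination hmn
        obtain ⟨h1, h2⟩ := eq_zero_of_comb_eq_zero h h0
        have := s.2
        have := s'.2
        have := t.2
        have := t'.2
        rcases hε with rfl | rfl <;> constructor <;> ext <;> omega
      have hst := eq_or_eq_neg_of_origin_eq hL (congrArg Subtype.val hst)
      rw [← QuotientAddGroup.mk_neg] at hst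
      have : s = s' ∧ t = t' := by
        rcases hst with hst | hst
        · refine key 1 (Or.inl rfl) ?_
          rw [eq_comm, QuotientAddGroup.eq] at hst
          convert hst using 1
          push_cast
          ring
        · refine key (-1) (Or.inr rfl) ?_
          rw [eq_comm, QuotientAddGroup.eq] at hst
          convert hst using 1
          push_cast
          ring
      rw [this.1, this.2]
    · rintro ⟨v, hv⟩
      obtain ⟨p, rfl⟩ := exists_origin_eq hL v
      obtain ⟨m, n, hmn⟩ := (latticeQuad_isSingular_iff hL p).1 hv
      have hp : p = m * a + n * b := mul_left_cancel₀ two_ne_zero hmn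
      refine ⟨(⟨(m % 2).toNat, by omega⟩, ⟨(n % 2).toNat, by omega⟩), ?_⟩
      refine Subtype.ext (congrArg (latticeQuad (spanTwo a b) hL).origin ((latticeDart_inj hL).2 ⟨?_, rfl⟩))
      rw [QuotientAddGroup.eq]
      refine ⟨m / 2, n / 2, ?_⟩
      have hm : m = m % 2 + 2 * (m / 2) := (Int.emod_add_mul_ediv m 2).symm
      have hn : n = n % 2 + 2 * (n / 2) := (Int.emod_add_mul_ediv n 2).symm
      dsimp only
      rw [Int.toNat_of_nonneg (by omega), Int.toNat_of_nonneg (by omega), hp]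
      have hm' : (m : GaussianInt) = (m % 2 : ℤ) + 2 * (m / 2 : ℤ) := by exact_mod_cast hm
      have hn' : (n : GaussianInt) = (n % 2 : ℤ) + 2 * (n / 2 : ℤ) := by exact_mod_cast hn
      linear_combination a * hm' + b * hn'
  rw [← Nat.card_congr (Equiv.ofBijective f hf)]
  simp

/-- The pillowcase quadrangulation of the triangle with vertices `0`, `2a`, `2b`. -/
def pillow (a b : GaussianInt) (h : gaussDet a b ≠ 0) : SphereQuad224 :=
  have := finite_quotient_spanTwo h
  ⟨latticeQuad (spanTwo a b) (isEvenLattice_spanTwo a b),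
    Quadrangulation.eulerChar_eq_two _ (latticeQuad_degree _)
      (card_singular_latticeQuad_spanTwo h _),
    card_singular_latticeQuad_spanTwo h _, latticeQuad_degree _⟩

theorem card_face_pillow (a b : GaussianInt) (h : gaussDet a b ≠ 0) :
    Nat.card (pillow a b h).1.Face = 2 * (gaussDet a b).natAbs := by
  have := finite_quotient_spanTwo h
  have h1 := (pillow a b h).1.card_dart_eq_faces
  have h2 := card_dart_latticeQuad _ (isEvenLattice_spanTwo a b)
  rw [index_spanTwo h] at h2
  have h3 : Nat.card (pillow a b h).1.Dart = 2 * (4 * (gaussDet a b).natAbs) := h2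
  omega

/-! ### Isomorphisms between quadrangulations of lattices -/

namespace Quadrangulation

variable {Q R : Quadrangulation}

theorem map_shift (e : Q.Dart ≃ R.Dart) (hn : ∀ d, e (Q.next d) = R.next (e d))
    (ho : ∀ d, e (Q.opp d) = R.opp (e d)) (p : GaussianInt) (d : Q.Dart) :
    e (Q.shift p d) = R.shift p (e d) := by
  have h1 : e.permCongrHom Q.next = R.next := by
    ext x; simp [hn]
  have h2 : e.permCongrHom Q.opp = R.opp := by
    ext x; simp [ho]
  have h3 : e.permCongrHom (Q.shift p) = R.shift p := by
    simp only [shift, leftward, forward, rot_eq, map_mul, map_zpow, map_inv, h1, h2]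
  rw [← h3]
  simp

theorem Iso.card_face (h : Iso Q R) : Nat.card Q.Face = Nat.card R.Face := by
  obtain ⟨e, -, -⟩ := h
  have := Nat.card_congr e
  rw [card_dart_eq_faces, card_dart_eq_faces] at this
  omega

theorem Glue.map (f : Q.Dart → R.Dart) (hn : ∀ d, f (Q.next d) = R.next (f d))
    (ho : ∀ d, f (Q.opp d) = R.opp (f d)) {x y : Q.Dart × unitSquare} (h : Q.Glue x y) :
    R.Glue (f x.1, x.2) (f y.1, y.2) := by
  cases h with
  | turn d w w' h =>
    dsimp only
    rw [hn]
    exact Glue.turn _ _ _ h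
  | side d w w' h0 h =>
    dsimp only
    rw [ho]
    exact Glue.side _ _ _ h0 h

theorem Iso.isFolding {z : ℂ × ℂ} (h : Iso Q R) (hz : IsFolding z Q) : IsFolding z R := by
  obtain ⟨e, h1, h2⟩ := h
  obtain ⟨k, hk1, hk2, hk3⟩ := hz
  let s : Q.Surface ≃ R.Surface := Quot.congr (e.prodCongr (Equiv.refl _)) fun x y =>
    ⟨fun h => h.map e h1 h2, fun h => by
      have := h.map e.symm (fun d => e.injective (by simp [h1])) fun d => e.injective (by simp [h2])
      simpa using this⟩
  refine ⟨s ∘ k, s.surjective.comp hk1, fun w w' => ?_, fun p => ?_⟩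
  · rw [← hk2]
    exact s.injective.eq_iff
  · obtain ⟨d, hd⟩ := hk3 p
    refine ⟨e d, fun w u hwu => ?_⟩
    rw [Function.comp_apply, hd w u hwu]
    rfl

end Quadrangulation

open Quadrangulation

/-- The stabiliser of the dart `(0, false)` is `L`. That of its image is `L'` or `L'` turned by a
quarter, according to the direction of the image and whatever its base point. -/
theorem iso_latticeQuad_iff {L L' : AddSubgroup GaussianInt} [Finite (GaussianInt ⧸ L)]
    [Finite (GaussianInt ⧸ L')] (hL : IsEvenLattice L) (hL' : IsEvenLattice L') :
    Iso (latticeQuad L hL) (latticeQuad L' hL') ↔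
      L = L' ∨ ∀ p, p ∈ L ↔ ⟨0, 1⟩ * p ∈ L' := by
  constructor
  · rintro ⟨e, h1, h2⟩
    obtain ⟨q, b, hq⟩ := latticeDart_surjective hL' (e (latticeDart hL 0 false))
    have key : ∀ p, p ∈ L ↔ (latticeQuad L' hL').shift p (latticeDart hL' q b) =
        latticeDart hL' q b := by
      intro p
      rw [← hq, ← map_shift e h1 h2, e.injective.eq_iff, latticeQuad_shift_false, latticeDart_inj]
      simp
    cases b
    · left
      ext p
      rw [key, latticeQuad_shift_false, latticeDart_inj]
      simp
    · right
      intro p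
      rw [key, latticeQuad_shift_true, latticeDart_inj]
      simp
  · rintro (rfl | h)
    · exact ⟨Equiv.refl _, fun _ => rfl, fun _ => rfl⟩
    · have hd : ((latticeQuad L' hL').rot ^ 2) (latticeDart hL' 0 true) =
          latticeDart hL' 0 true := by
        rw [latticeQuad_rot_sq, neg_zero]
      obtain ⟨_, _, hiso⟩ := exists_iso_latticeQuad (latticeQuad_rot_pow_four hL')
        (latticeQuad_rot_ne hL') hd
      have hp : periodLattice (latticeQuad_rot_pow_four hL') (latticeDart hL' 0 true) = L := by
        ext p
        rw [mem_periodLattice, latticeQuad_shift_true, latticeDart_inj, h]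
        simp
      subst hp
      exact hiso

theorem exists_iso_pillow (Q : SphereQuad224) :
    ∃ (a b : GaussianInt) (h : 0 < gaussDet a b), Iso (pillow a b h.ne').1 Q.1 := by
  obtain ⟨Q, -, hcard, h2⟩ := Q
  have : Nonempty {v : Q.Vertex // Q.IsSingular v} := by
    by_contra hne
    rw [not_nonempty_iff] at hne
    simp at hcard
  obtain ⟨v, hv⟩ := this
  induction v using Quotient.inductionOn with
  | h d =>
    have h4 := Q.rot_pow_four h2
    have h1 := Q.rot_ne h2
    have hd := (Q.isSingular_origin_iff h4 h1 d).1 hv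
    obtain ⟨hfin, hL, hiso⟩ := exists_iso_latticeQuad h4 h1 hd
    obtain ⟨a, b, hab, heq⟩ := exists_eq_spanTwo _ hL
    refine ⟨a, b, hab, ?_⟩
    -- The finiteness and evenness proofs depend on the lattice, so they are rewritten along with
    -- it.
    revert hfin hL hiso
    rw [heq]
    exact fun _ _ h => h

/-! ### The action of `⟨√-1⟩ × SL(2, ℤ)` -/

theorem zpowers_unitI_cases (u : Subgroup.zpowers unitI) :
    ∃ v : GaussianInt, ((u : ℂˣ) : ℂ) = (v : ℂ) ∧
      (v = 1 ∨ v = -1 ∨ v = ⟨0, 1⟩ ∨ v = ⟨0, -1⟩) := by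
  obtain ⟨v, hv⟩ := zpowers_unitI_gauss u
  refine ⟨v, hv, ?_⟩
  have h := zpowers_unitI_norm u
  rw [hv, Complex.mul_conj, ← GaussianInt.intCast_real_norm] at h
  have h : v.norm = 1 := by exact_mod_cast h
  rw [Zsqrtd.norm_def] at h
  obtain ⟨x, y⟩ := v
  dsimp only at h
  have hx : -1 ≤ x ∧ x ≤ 1 := by constructor <;> nlinarith [mul_self_nonneg y]
  have hy : -1 ≤ y ∧ y ≤ 1 := by constructor <;> nlinarith [mul_self_nonneg x]
  obtain ⟨hx1, hx2⟩ := hx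
  obtain ⟨hy1, hy2⟩ := hy
  interval_cases x <;> interval_cases y <;> simp_all [Zsqrtd.ext_iff]

theorem mem_spanTwo_mul {a b v : GaussianInt} {α β γ δ : ℤ} (h : α * δ - β * γ = 1)
    (p : GaussianInt) :
    p ∈ spanTwo (v * (α * a + β * b)) (v * (γ * a + δ * b)) ↔
      ∃ m n : ℤ, p = v * (2 * (m * a + n * b)) := by
  rw [mem_spanTwo]
  have h' : (α * δ - β * γ : GaussianInt) = 1 := by exact_mod_cast h
  constructor
  · rintro ⟨m, n, rfl⟩
    exact ⟨m * α + n * γ, m * β + n * δ, by push_cast; ring⟩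
  · rintro ⟨m, n, rfl⟩
    -- The coefficients come from the inverse of a matrix of determinant 1.
    refine ⟨m * δ - n * γ, n * α - m * β, ?_⟩
    push_cast
    linear_combination (-(2 * v * (m * a + n * b))) * h'

/-- A base change in `SL(2, ℤ)` and a factor `±1` preserve the lattice; a factor `±√-1` turns it by
a quarter, the sign being immaterial. -/
theorem spanTwo_act {a b v : GaussianInt} {α β γ δ : ℤ} (h : α * δ - β * γ = 1)
    (hv : v = 1 ∨ v = -1 ∨ v = ⟨0, 1⟩ ∨ v = ⟨0, -1⟩) :
    spanTwo (v * (α * a + β * b)) (v * (γ * a + δ * b)) = spanTwo a b ∨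
      ∀ p, p ∈ spanTwo (v * (α * a + β * b)) (v * (γ * a + δ * b)) ↔
        ⟨0, 1⟩ * p ∈ spanTwo a b := by
  have hI : (⟨0, 1⟩ * ⟨0, 1⟩ : GaussianInt) = -1 := by ext <;> simp
  have hI' : (⟨0, -1⟩ : GaussianInt) = -⟨0, 1⟩ := by ext <;> simp
  rcases hv with rfl | rfl | rfl | rfl
  · left
    ext p
    rw [mem_spanTwo_mul h]
    simp only [one_mul, mem_spanTwo]
  · left
    ext p
    rw [mem_spanTwo_mul h, mem_spanTwo]
    constructor <;> rintro ⟨m, n, rfl⟩ <;> exact ⟨-m, -n, by push_cast; ring⟩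
  · right
    intro p
    rw [mem_spanTwo_mul h, mem_spanTwo]
    constructor
    · rintro ⟨m, n, rfl⟩
      refine ⟨-m, -n, ?_⟩
      push_cast
      linear_combination (2 * (m * a + n * b) : GaussianInt) * hI
    · rintro ⟨m, n, hmn⟩
      refine ⟨-m, -n, ?_⟩
      push_cast
      linear_combination p * hI - (⟨0, 1⟩ : GaussianInt) * hmn
  · right
    intro p
    rw [mem_spanTwo_mul h, mem_spanTwo, hI']
    constructor
    · rintro ⟨m, n, rfl⟩
      refine ⟨m, n, ?_⟩
      linear_combination (-(2 * (m * a + n * b)) : GaussianInt) * hI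
    · rintro ⟨m, n, hmn⟩
      refine ⟨m, n, ?_⟩
      linear_combination p * hI - (⟨0, 1⟩ : GaussianInt) * hmn

theorem gaussDet_comb (a b : GaussianInt) (α β γ δ : ℤ) :
    gaussDet (α * a + β * b) (γ * a + δ * b) = (α * δ - β * γ) * gaussDet a b := by
  simp [gaussDet]
  ring

/-- Two positively oriented bases of the same lattice differ by an element of `SL(2, ℤ)`. -/
theorem exists_comb_of_spanTwo_eq {a b a' b' : GaussianInt} (h : 0 < gaussDet a b)
    (h' : 0 < gaussDet a' b') (he : spanTwo a' b' = spanTwo a b) :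
    ∃ α β γ δ : ℤ, α * δ - β * γ = 1 ∧ a' = α * a + β * b ∧ b' = γ * a + δ * b := by
  have key : ∀ {a b a' b' : GaussianInt}, spanTwo a' b' = spanTwo a b →
      ∃ α β γ δ : ℤ, a' = α * a + β * b ∧ b' = γ * a + δ * b := by
    intro a b a' b' he
    obtain ⟨α, β, h1⟩ : 2 * a' ∈ spanTwo a b := he ▸ ⟨1, 0, by simp⟩
    obtain ⟨γ, δ, h2⟩ : 2 * b' ∈ spanTwo a b := he ▸ ⟨0, 1, by simp⟩
    exact ⟨α, β, γ, δ, mul_left_cancel₀ two_ne_zero h1, mul_left_cancel₀ two_ne_zero h2⟩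
  obtain ⟨α, β, γ, δ, h1, h2⟩ := key he
  obtain ⟨ξ, η, ζ, θ, h3, h4⟩ := key he.symm
  refine ⟨α, β, γ, δ, ?_, h1, h2⟩
  have e1 := gaussDet_comb a b α β γ δ
  have e2 := gaussDet_comb a' b' ξ η ζ θ
  rw [← h1, ← h2] at e1
  rw [← h3, ← h4] at e2
  set x := α * δ - β * γ
  set y := ξ * θ - η * ζ
  -- The two base changes have inverse integer determinants, both positive since the orientations
  -- agree.
  have hxy : y * x = 1 := by
    have : (y * x) * gaussDet a b = 1 * gaussDet a b := by
      rw [mul_assoc, ← e1, ← e2, one_mul]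
    exact mul_right_cancel₀ h.ne' this
  have hx : 0 < x := by
    by_contra hx
    nlinarith
  have hy : 0 < y := by
    by_contra hy
    nlinarith
  nlinarith

/-! ### Coordinates of lattice points, and their quadrangulations -/

theorem areaForm_gauss (a b : GaussianInt) :
    areaForm (2 * (a : ℂ), 2 * (b : ℂ)) (2 * (a : ℂ), 2 * (b : ℂ)) =
      ((2 * gaussDet a b : ℤ) : ℂ) := by
  simp only [areaForm, GaussianInt.toComplex_def, map_mul, map_add, Complex.conj_I, map_intCast,
    map_ofNat, gaussDet]
  push_cast
  linear_combination (2 * (a.im * b.re - a.re * b.im) : ℂ) * Complex.I_sq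

theorem exists_coords (z : gaussLatticePos) :
    ∃ a b : GaussianInt, 0 < gaussDet a b ∧ z.1 = (2 * (a : ℂ), 2 * (b : ℂ)) := by
  obtain ⟨_, ⟨a, b, rfl⟩, hpos⟩ := z
  refine ⟨a, b, ?_, rfl⟩
  rw [areaForm_gauss, Complex.intCast_re] at hpos
  have : 0 < 2 * gaussDet a b := by exact_mod_cast hpos
  linarith

noncomputable def coordA (z : gaussLatticePos) : GaussianInt := (exists_coords z).choose

noncomputable def coordB (z : gaussLatticePos) : GaussianInt := (exists_coords z).choose_spec.choose

theorem gaussDet_coord_pos (z : gaussLatticePos) : 0 < gaussDet (coordA z) (coordB z) :=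
  (exists_coords z).choose_spec.choose_spec.1

theorem eq_coord (z : gaussLatticePos) : z.1 = (2 * (coordA z : ℂ), 2 * (coordB z : ℂ)) :=
  (exists_coords z).choose_spec.choose_spec.2

theorem coord_eq_of {z : gaussLatticePos} {a b : GaussianInt}
    (h : z.1 = (2 * (a : ℂ), 2 * (b : ℂ))) : coordA z = a ∧ coordB z = b := by
  rw [eq_coord z, Prod.mk_inj] at h
  constructor
  · exact GaussianInt.toComplex_inj.1 (mul_left_cancel₀ two_ne_zero h.1)
  · exact GaussianInt.toComplex_inj.1 (mul_left_cancel₀ two_ne_zero h.2)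

/-- The pillowcase of the triangle with vertices `0`, `z₁`, `z₂`. -/
noncomputable def pillowOf (z : gaussLatticePos) : SphereQuad224 :=
  pillow (coordA z) (coordB z) (gaussDet_coord_pos z).ne'

theorem coord_smul (g : CutGlueGroup) (v : GaussianInt) (hv : ((g.1 : ℂˣ) : ℂ) = (v : ℂ))
    (z : gaussLatticePos) :
    coordA (g • z) = v * ((g.2.1 0 0 : ℤ) * coordA z + (g.2.1 0 1 : ℤ) * coordB z) ∧
      coordB (g • z) = v * ((g.2.1 1 0 : ℤ) * coordA z + (g.2.1 1 1 : ℤ) * coordB z) := by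
  refine coord_eq_of ?_
  change cutGlue g z.1 = _
  rw [eq_coord z]
  simp only [cutGlue, hv, map_mul, map_add, map_intCast, Prod.mk.injEq]
  constructor <;> ring

theorem det_eq_one (A : Matrix.SpecialLinearGroup (Fin 2) ℤ) :
    A.1 0 0 * A.1 1 1 - A.1 0 1 * A.1 1 0 = 1 := by
  rw [← Matrix.det_fin_two]
  exact A.2

theorem iso_pillowOf_iff (z w : gaussLatticePos) :
    Iso (pillowOf z).1 (pillowOf w).1 ↔
      spanTwo (coordA z) (coordB z) = spanTwo (coordA w) (coordB w) ∨
      ∀ p, p ∈ spanTwo (coordA z) (coordB z) ↔ ⟨0, 1⟩ * p ∈ spanTwo (coordA w) (coordB w) := by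
  have := finite_quotient_spanTwo (gaussDet_coord_pos z).ne'
  have := finite_quotient_spanTwo (gaussDet_coord_pos w).ne'
  exact iso_latticeQuad_iff (isEvenLattice_spanTwo _ _) (isEvenLattice_spanTwo _ _)

theorem iso_pillowOf_smul (g : CutGlueGroup) (z : gaussLatticePos) :
    Iso (pillowOf (g • z)).1 (pillowOf z).1 := by
  obtain ⟨v, hv, hcases⟩ := zpowers_unitI_cases g.1
  obtain ⟨h1, h2⟩ := coord_smul g v hv z
  rw [iso_pillowOf_iff, h1, h2]
  exact spanTwo_act (det_eq_one g.2) hcases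

theorem exists_smul_eq_of_span_eq {z w : gaussLatticePos}
    (h : spanTwo (coordA z) (coordB z) = spanTwo (coordA w) (coordB w)) :
    ∃ g : CutGlueGroup, g • w = z := by
  obtain ⟨α, β, γ, δ, hdet, h1, h2⟩ :=
    exists_comb_of_spanTwo_eq (gaussDet_coord_pos w) (gaussDet_coord_pos z) h
  let g : CutGlueGroup := (1, ⟨!![α, β; γ, δ], by rw [Matrix.det_fin_two_of]; exact hdet⟩)
  refine ⟨g, Subtype.ext ?_⟩
  obtain ⟨k1, k2⟩ := coord_smul g 1 (by simp [g]) w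
  have k1 : coordA (g • w) = 1 * (α * coordA w + β * coordB w) := k1
  have k2 : coordB (g • w) = 1 * (γ * coordA w + δ * coordB w) := k2
  rw [eq_coord, eq_coord z, k1, k2, h1, h2, one_mul, one_mul]

theorem exists_smul_eq_of_iso {z w : gaussLatticePos}
    (h : Iso (pillowOf z).1 (pillowOf w).1) : ∃ g : CutGlueGroup, g • w = z := by
  rcases (iso_pillowOf_iff z w).1 h with h | h
  · exact exists_smul_eq_of_span_eq h
  -- Multiplying `z` by `√-1` first makes the lattices equal and reduces to the previous case.
  · let g : CutGlueGroup := (⟨unitI, Subgroup.mem_zpowers _⟩, 1)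
    have hI : ((⟨0, 1⟩ : GaussianInt) : ℂ) = Complex.I := by
      simp [GaussianInt.toComplex_def]
    obtain ⟨k1, k2⟩ := coord_smul g ⟨0, 1⟩ (by rw [hI]; rfl) z
    have k1 : coordA (g • z) = ⟨0, 1⟩ * (((1 : ℤ) : GaussianInt) * coordA z +
      ((0 : ℤ) : GaussianInt) * coordB z) := k1
    have k2 : coordB (g • z) = ⟨0, 1⟩ * (((0 : ℤ) : GaussianInt) * coordA z +
      ((1 : ℤ) : GaussianInt) * coordB z) := k2
    have hsp : spanTwo (coordA (g • z)) (coordB (g • z)) = spanTwo (coordA w) (coordB w) := by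
      have hII : (⟨0, 1⟩ * ⟨0, 1⟩ : GaussianInt) = -1 := by ext <;> simp
      ext p
      rw [k1, k2, mem_spanTwo_mul (by norm_num)]
      constructor
      · rintro ⟨m, n, rfl⟩
        exact (h _).1 ⟨m, n, rfl⟩
      · intro hp
        obtain ⟨m, n, hmn⟩ := (h (-⟨0, 1⟩ * p)).2 (by
          convert hp using 1
          linear_combination (-p) * hII)
        refine ⟨m, n, ?_⟩
        linear_combination (⟨0, 1⟩ : GaussianInt) * hmn + p * hII
    obtain ⟨k, hk⟩ := exists_smul_eq_of_span_eq hsp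
    exact ⟨g⁻¹ * k, by rw [mul_smul, hk, inv_smul_smul]⟩

theorem exists_iso_pillowOf (Q : SphereQuad224) : ∃ z, Iso (pillowOf z).1 Q.1 := by
  obtain ⟨a, b, hpos, hiso⟩ := exists_iso_pillow Q
  let z : gaussLatticePos := ⟨(2 * (a : ℂ), 2 * (b : ℂ)), ⟨a, b, rfl⟩, by
    rw [areaForm_gauss, Complex.intCast_re]
    exact_mod_cast (by linarith : 0 < 2 * gaussDet a b)⟩
  have hz := coord_eq_of (z := z) rfl
  have he : pillowOf z = pillow a b hpos.ne' := by
    simp only [pillowOf, hz.1, hz.2]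
  exact ⟨z, he ▸ hiso⟩

/-! ### The bijection on classes -/

noncomputable def pillowClass :
    MulAction.orbitRel.Quotient CutGlueGroup gaussLatticePos → HGGauss224 :=
  Quotient.lift (fun z => Quotient.mk sphereQuadSetoid (pillowOf z)) fun _ w ⟨g, hg⟩ =>
    Quotient.sound (by
      subst hg
      exact iso_pillowOf_smul g w)

theorem pillowClass_bijective : Function.Bijective pillowClass := by
  constructor
  · intro x y
    induction x using Quotient.inductionOn with
    | h z =>
      induction y using Quotient.inductionOn with
      | h w =>
        intro h
        exact Quotient.sound (exists_smul_eq_of_iso (Quotient.exact h))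
  · intro x
    induction x using Quotient.inductionOn with
    | h Q =>
      obtain ⟨z, hz⟩ := exists_iso_pillowOf Q
      exact ⟨Quotient.mk _ z, Quotient.sound hz⟩

/-! ### The plane modulo the half-turns about half the points of a lattice -/

/-- Equality modulo the maps `w ↦ ±w + l`, `l ∈ L`. -/
def pillowSetoid (L : AddSubgroup GaussianInt) : Setoid ℂ where
  r w w' := ∃ l ∈ L, w' = w + (l : ℂ) ∨ w' = -w + (l : ℂ)
  iseqv :=
    { refl := fun w => ⟨0, L.zero_mem, Or.inl (by simp)⟩
      symm := by
        rintro w w' ⟨l, hl, rfl | rfl⟩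
        · exact ⟨-l, L.neg_mem hl, Or.inl (by simp)⟩
        · exact ⟨l, hl, Or.inr (by ring)⟩
      trans := by
        rintro w w' w'' ⟨l, hl, rfl | rfl⟩ ⟨k, hk, rfl | rfl⟩
        · exact ⟨l + k, L.add_mem hl hk, Or.inl (by simp [add_assoc])⟩
        · exact ⟨-l + k, L.add_mem (L.neg_mem hl) hk, Or.inr (by simp; ring)⟩
        · exact ⟨l + k, L.add_mem hl hk, Or.inr (by simp [add_assoc])⟩
        · exact ⟨-l + k, L.add_mem (L.neg_mem hl) hk, Or.inl (by simp; ring)⟩ }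

theorem toComplex_zero_one : ((⟨0, 1⟩ : GaussianInt) : ℂ) = Complex.I := by
  simp [GaussianInt.toComplex_def]

section

variable {L : AddSubgroup GaussianInt} [Finite (GaussianInt ⧸ L)] (hL : IsEvenLattice L)

/-- The point `u` of the square with lower left corner `p`. -/
def gridPoint (p : GaussianInt) (u : unitSquare) : (latticeQuad L hL).Surface :=
  Quot.mk _ (latticeDart hL p false, u)

theorem turn_eq (d : (latticeQuad L hL).Dart) (w w' : unitSquare)
    (h : (w' : ℂ) = 1 + Complex.I * w) :
    (Quot.mk _ ((latticeQuad L hL).next d, w) : (latticeQuad L hL).Surface) = Quot.mk _ (d, w') :=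
  Quot.sound (Glue.turn d w w' h)

theorem side_eq (d : (latticeQuad L hL).Dart) (w w' : unitSquare) (h0 : (w : ℂ).im = 0)
    (h : (w' : ℂ) = 1 - w) :
    (Quot.mk _ (d, w) : (latticeQuad L hL).Surface) = Quot.mk _ ((latticeQuad L hL).opp d, w') :=
  Quot.sound (Glue.side d w w' h0 h)

theorem turn_mem {w : ℂ} (hw : w ∈ unitSquare) : 1 + Complex.I * w ∈ unitSquare := by
  obtain ⟨h1, h2, h3, h4⟩ := hw
  refine ⟨?_, ?_, ?_, ?_⟩ <;> simp <;> linarith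

/-- Redrawing the square from the opposite side, by two `turn` gluings, is the half-turn `u ↦ 1 +
√-1 - u`. -/
theorem gridPoint_halfTurn (p : GaussianInt) (u v : unitSquare)
    (h : (u : ℂ) + v = 1 + Complex.I) :
    gridPoint hL (-p - 1 - ⟨0, 1⟩) v = gridPoint hL p u := by
  unfold gridPoint
  have e : latticeDart hL ((-p - 1 - ⟨0, 1⟩ : GaussianInt) : GaussianInt ⧸ L) false =
      (latticeQuad L hL).next ((latticeQuad L hL).next (latticeDart hL p false)) := by
    rw [latticeQuad_next_false, latticeQuad_next_true, latticeDart_inj, ← QuotientAddGroup.mk_add,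
      ← QuotientAddGroup.mk_neg, ← QuotientAddGroup.mk_sub]
    exact ⟨by congr 1; ring, rfl⟩
  rw [e, turn_eq hL _ v ⟨_, turn_mem v.2⟩ rfl, turn_eq hL _ _ u]
  dsimp only
  linear_combination h - (v : ℂ) * Complex.I_sq

/-- The `side` gluing on the bottom of the upper square lands in a half-turned copy of the lower
one; `gridPoint_halfTurn` turns it back. -/
theorem gridPoint_above (p : GaussianInt) (u v : unitSquare) (h : (u : ℂ) = Complex.I + v) :
    gridPoint hL p u = gridPoint hL (p + ⟨0, 1⟩) v := by
  have hv : (v : ℂ).im = 0 := by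
    have h1 := u.2.2.2.2
    have h2 := v.2.2.2.1
    rw [h] at h1
    simp at h1
    linarith
  have hv' : (1 - v : ℂ) ∈ unitSquare := by
    obtain ⟨h1, h2, h3, h4⟩ := v.2
    refine ⟨?_, ?_, ?_, ?_⟩ <;> simp <;> linarith
  rw [← gridPoint_halfTurn hL p u ⟨_, hv'⟩ (by rw [h]; dsimp only; ring)]
  unfold gridPoint
  rw [side_eq hL (latticeDart hL ((p + ⟨0, 1⟩ : GaussianInt) : GaussianInt ⧸ L) false) v
    ⟨_, hv'⟩ hv rfl, latticeQuad_opp_false, ← QuotientAddGroup.mk_neg, ← QuotientAddGroup.mk_sub]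
  congr 4
  ring

theorem gridPoint_right (p : GaussianInt) (u v : unitSquare) (h : (u : ℂ) = 1 + v) :
    gridPoint hL p u = gridPoint hL (p + 1) v := by
  have hv : (v : ℂ).re = 0 := by
    have h1 := u.2.2.1
    have h2 := v.2.1
    rw [h] at h1
    simp at h1
    linarith
  have hy : (-Complex.I * v : ℂ) ∈ unitSquare := by
    obtain ⟨h1, h2, h3, h4⟩ := v.2
    refine ⟨?_, ?_, ?_, ?_⟩ <;> simp <;> linarith
  have hu : (u : ℂ) = 1 + Complex.I * (-Complex.I * v) := by
    linear_combination h + (v : ℂ) * Complex.I_sq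
  unfold gridPoint
  have e : latticeDart hL ((p + 1 : GaussianInt) : GaussianInt ⧸ L) false =
      (latticeQuad L hL).next ((latticeQuad L hL).opp
        ((latticeQuad L hL).next (latticeDart hL p false))) := by
    rw [latticeQuad_next_false, latticeQuad_opp_true, latticeQuad_next_true, latticeDart_inj]
    refine ⟨?_, rfl⟩
    simp
  rw [e, turn_eq hL _ v ⟨_, turn_mem v.2⟩ rfl, ← turn_eq hL _ ⟨_, hy⟩ u hu]
  exact side_eq hL _ _ _ (by simp [hv]) (by dsimp only; ring)

theorem gridPoint_right_zmul (p : GaussianInt) (u v : unitSquare) (m : ℤ) (h : (u : ℂ) = m + v) :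
    gridPoint hL p u = gridPoint hL (p + m) v := by
  have h1 := u.2.2.1
  have h2 := v.2.1
  have h3 := u.2.1
  have h4 := v.2.2.1
  rw [h] at h1 h3
  simp only [Complex.add_re, Complex.intCast_re] at h1 h3
  -- Both points lie in the unit square, so they differ by at most one step.
  have hm1 : m ≤ 1 := by exact_mod_cast (by linarith : (m : ℝ) ≤ 1)
  have hm2 : -1 ≤ m := by exact_mod_cast (by linarith : (-1 : ℝ) ≤ m)
  interval_cases m
  · rw [gridPoint_right hL _ v u (by rw [h]; push_cast; ring)]
    congr 1
    push_cast; ring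
  · have : u = v := Subtype.ext (by rw [h]; simp)
    rw [this]; simp
  · rw [gridPoint_right hL p u v (by rw [h]; simp)]
    simp

theorem gridPoint_above_zmul (p : GaussianInt) (u v : unitSquare) (m : ℤ)
    (h : (u : ℂ) = m * Complex.I + v) :
    gridPoint hL p u = gridPoint hL (p + m * ⟨0, 1⟩) v := by
  have h1 := u.2.2.2.2
  have h2 := v.2.2.2.1
  have h3 := u.2.2.2.1
  have h4 := v.2.2.2.2
  rw [h] at h1 h3
  simp at h1 h3
  have hm1 : m ≤ 1 := by exact_mod_cast (by linarith : (m : ℝ) ≤ 1)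
  have hm2 : -1 ≤ m := by exact_mod_cast (by linarith : (-1 : ℝ) ≤ m)
  interval_cases m
  · rw [gridPoint_above hL _ v u (by rw [h]; push_cast; ring)]
    congr 1
    push_cast; ring
  · have : u = v := Subtype.ext (by rw [h]; simp)
    rw [this]; simp
  · rw [gridPoint_above hL p u v (by rw [h]; simp)]
    simp

theorem gridPoint_eq_of_eq (p q : GaussianInt) (u v : unitSquare)
    (h : (p : ℂ) + u = q + v) : gridPoint hL p u = gridPoint hL q v := by
  have hre := congrArg Complex.re h
  have him := congrArg Complex.im h
  simp at hre him
  -- The intermediate point has the real part of `v` and the imaginary part of `u`: cross a vertical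
  -- side first, then a horizontal one.
  have hw : (u : ℂ) - ((q.re - p.re : ℤ) : ℂ) ∈ unitSquare := by
    obtain ⟨h1, h2, h3, h4⟩ := v.2
    obtain ⟨h1', h2', h3', h4'⟩ := u.2
    refine ⟨?_, ?_, ?_, ?_⟩ <;> simp <;> linarith
  rw [gridPoint_right_zmul hL p u ⟨_, hw⟩ (q.re - p.re) (by dsimp only; ring),
    gridPoint_above_zmul hL _ ⟨_, hw⟩ v (q.im - p.im)]
  · congr 1
    ext <;> simp
  · apply Complex.ext <;> simp <;> linarith

/-- The projection of the plane onto the surface. -/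
noncomputable def planeProj (w : ℂ) : (latticeQuad L hL).Surface :=
  gridPoint hL ⟨⌊w.re⌋, ⌊w.im⌋⟩ ⟨⟨Int.fract w.re, Int.fract w.im⟩, by
    refine ⟨Int.fract_nonneg _, (Int.fract_lt_one _).le, Int.fract_nonneg _,
      (Int.fract_lt_one _).le⟩⟩

theorem exists_grid (w : ℂ) : ∃ (p : GaussianInt) (u : unitSquare), w = (p : ℂ) + u := by
  refine ⟨⟨⌊w.re⌋, ⌊w.im⌋⟩, ⟨⟨Int.fract w.re, Int.fract w.im⟩, Int.fract_nonneg _,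
    (Int.fract_lt_one _).le, Int.fract_nonneg _, (Int.fract_lt_one _).le⟩, ?_⟩
  apply Complex.ext <;> simp

theorem planeProj_eq {w : ℂ} {p : GaussianInt} {u : unitSquare} (h : w = (p : ℂ) + u) :
    planeProj hL w = gridPoint hL p u := by
  refine gridPoint_eq_of_eq hL _ _ _ _ ?_
  rw [← h]
  apply Complex.ext <;> simp

theorem gridPoint_add_mem (p : GaussianInt) (u : unitSquare) {l : GaussianInt} (hl : l ∈ L) :
    gridPoint hL (p + l) u = gridPoint hL p u := by
  unfold gridPoint
  rw [QuotientAddGroup.mk_add, (QuotientAddGroup.eq_zero_iff l).2 hl, add_zero]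

theorem planeProj_eq_of_rel {w w' : ℂ} (h : pillowSetoid L w w') :
    planeProj hL w = planeProj hL w' := by
  obtain ⟨l, hl, rfl | rfl⟩ := h
  · obtain ⟨p, u, rfl⟩ := exists_grid w
    rw [planeProj_eq hL rfl, planeProj_eq hL (p := p + l) (u := u) (by simp; ring),
      gridPoint_add_mem hL _ _ hl]
  · obtain ⟨p, u, rfl⟩ := exists_grid w
    have hv : (1 + Complex.I - u : ℂ) ∈ unitSquare := by
      obtain ⟨h1, h2, h3, h4⟩ := u.2
      refine ⟨?_, ?_, ?_, ?_⟩ <;> simp <;> linarith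
    rw [planeProj_eq hL rfl, planeProj_eq hL (p := -p - 1 - ⟨0, 1⟩ + l) (u := ⟨_, hv⟩),
      gridPoint_add_mem hL _ _ hl, gridPoint_halfTurn hL p u _ (by dsimp only; ring)]
    simp only [GaussianInt.toComplex_add, GaussianInt.toComplex_sub, GaussianInt.toComplex_neg,
      GaussianInt.toComplex_one, toComplex_zero_one]
    ring

theorem planeProj_surjective : Function.Surjective (planeProj hL) := by
  intro x
  induction x using Quot.inductionOn with
  | h x =>
    obtain ⟨d, v⟩ := x
    obtain ⟨p, _ | _, rfl⟩ := latticeDart_surjective hL d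
    · exact ⟨_, planeProj_eq hL rfl⟩
    · refine ⟨((p - 1 : GaussianInt) : ℂ) + (1 + Complex.I * v), ?_⟩
      rw [planeProj_eq hL (u := ⟨_, turn_mem v.2⟩) rfl, gridPoint, ← turn_eq hL _ v _ rfl,
        latticeQuad_next_false, ← QuotientAddGroup.mk_add, sub_add_cancel]

/-- The inverse of `planeProj`, on the level of darts. -/
def dartPoint (x : (latticeQuad L hL).Dart × unitSquare) : Quotient (pillowSetoid L) :=
  Quotient.liftOn' x.1.1
    (fun p => Quotient.mk (pillowSetoid L)
      ((p : ℂ) + (bif x.1.2 then Complex.I else 1) * (x.2 : ℂ)))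
    fun p q h => by
      rw [QuotientAddGroup.leftRel_apply] at h
      refine Quotient.sound ⟨-p + q, h, Or.inl ?_⟩
      simp only [GaussianInt.toComplex_add, GaussianInt.toComplex_neg]
      ring

theorem dartPoint_false (p : GaussianInt) (u : unitSquare) :
    dartPoint hL (latticeDart hL p false, u) = Quotient.mk (pillowSetoid L) ((p : ℂ) + u) := by
  change Quotient.mk (pillowSetoid L) ((p : ℂ) + 1 * (u : ℂ)) = _
  rw [one_mul]

theorem dartPoint_true (p : GaussianInt) (u : unitSquare) :
    dartPoint hL (latticeDart hL p true, u) =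
      Quotient.mk (pillowSetoid L) ((p : ℂ) + Complex.I * u) := rfl

theorem dartPoint_eq_of_glue (x y : (latticeQuad L hL).Dart × unitSquare)
    (h : (latticeQuad L hL).Glue x y) : dartPoint hL x = dartPoint hL y := by
  cases h with
  | turn d w w' h =>
    obtain ⟨p, _ | _, rfl⟩ := latticeDart_surjective hL d
    · rw [latticeQuad_next_false, ← QuotientAddGroup.mk_add, dartPoint_true, dartPoint_false, h]
      congr 1
      simp
      ring
    · rw [latticeQuad_next_true, ← QuotientAddGroup.mk_neg, ← QuotientAddGroup.mk_sub,
        dartPoint_true, dartPoint_false, h]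
      refine Quotient.sound ⟨0, L.zero_mem, Or.inr ?_⟩
      simp only [GaussianInt.toComplex_sub, GaussianInt.toComplex_neg, toComplex_zero_one,
        GaussianInt.toComplex_zero]
      linear_combination (w : ℂ) * Complex.I_sq
  | side d w w' h0 h =>
    obtain ⟨p, _ | _, rfl⟩ := latticeDart_surjective hL d
    · rw [latticeQuad_opp_false, ← QuotientAddGroup.mk_neg, ← QuotientAddGroup.mk_sub,
        dartPoint_false, dartPoint_false, h]
      refine Quotient.sound ⟨0, L.zero_mem, Or.inr ?_⟩
      simp only [GaussianInt.toComplex_sub, GaussianInt.toComplex_neg, GaussianInt.toComplex_one,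
        GaussianInt.toComplex_zero]
      ring
    · rw [latticeQuad_opp_true, ← QuotientAddGroup.mk_neg, ← QuotientAddGroup.mk_sub,
        dartPoint_true, dartPoint_true, h]
      refine Quotient.sound ⟨0, L.zero_mem, Or.inr ?_⟩
      simp only [GaussianInt.toComplex_sub, GaussianInt.toComplex_neg, toComplex_zero_one,
        GaussianInt.toComplex_zero]
      ring

theorem planeProj_eq_iff {w w' : ℂ} :
    planeProj hL w = planeProj hL w' ↔ pillowSetoid L w w' := by
  refine ⟨fun h => ?_, planeProj_eq_of_rel hL⟩
  -- `dartPoint` respects the gluing, so it descends to the surface and recovers the class of `w`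
  -- from its projection.
  have key : ∀ w, Quot.lift (dartPoint hL) (dartPoint_eq_of_glue hL) (planeProj hL w) =
      Quotient.mk (pillowSetoid L) w := by
    intro w
    obtain ⟨p, u, rfl⟩ := exists_grid w
    rw [planeProj_eq hL rfl]
    exact dartPoint_false hL p u
  have h2 := key w
  rw [h, key w'] at h2
  exact Quotient.exact h2.symm

end

/-! ### The triangle as a fundamental domain -/

theorem mem_triangle {z : ℂ × ℂ} {w : ℂ} :
    w ∈ triangle z ↔ ∃ x y : ℝ, 0 ≤ x ∧ 0 ≤ y ∧ x + y ≤ 1 ∧ w = x * z.1 + y * z.2 := by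
  constructor
  · intro h
    refine convexHull_min (t := {w | ∃ x y : ℝ, 0 ≤ x ∧ 0 ≤ y ∧ x + y ≤ 1 ∧
      w = x * z.1 + y * z.2}) ?_ ?_ h
    · rintro _ (rfl | rfl | rfl)
      · exact ⟨0, 0, by simp⟩
      · exact ⟨1, 0, by simp⟩
      · exact ⟨0, 1, by simp⟩
    · rintro _ ⟨x, y, h1, h2, h3, rfl⟩ _ ⟨x', y', h1', h2', h3', rfl⟩ s t hs ht hst
      refine ⟨s * x + t * x', s * y + t * y', by positivity, by positivity, ?_, ?_⟩
      · nlinarith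
      · simp only [Complex.real_smul]
        push_cast
        ring
  · rintro ⟨x, y, h1, h2, h3, rfl⟩
    have hc := convex_convexHull ℝ ({0, z.1, z.2} : Set ℂ)
    have m0 : (0 : ℂ) ∈ triangle z := subset_convexHull ℝ _ (by simp)
    have m1 : z.1 ∈ triangle z := subset_convexHull ℝ _ (by simp)
    have m2 : z.2 ∈ triangle z := subset_convexHull ℝ _ (by simp)
    have := hc.sum_mem (t := Finset.univ) (w := ![1 - x - y, x, y]) (z := ![0, z.1, z.2])
      (by intro i _; fin_cases i <;> simp <;> linarith)
      (by simp [Fin.sum_univ_three]; ring)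
      (by intro i _; fin_cases i <;> simpa)
    simpa [Fin.sum_univ_three, triangle] using this

section

variable {z : ℂ × ℂ}

theorem sideFold_one {x x' : ℝ} (hx : 0 ≤ x) (hx' : 0 ≤ x') (h : x + x' = 1) :
    SideFold z (x * z.1) (x' * z.1) := by
  refine ⟨(0, z.1), by simp, ⟨x', x, hx', hx, by linarith, by simp⟩, ?_⟩
  have h : (x + x' : ℂ) = 1 := by exact_mod_cast h
  dsimp only
  linear_combination z.1 * h

theorem sideFold_two {x x' : ℝ} (hx : 0 ≤ x) (hx' : 0 ≤ x') (h : x + x' = 1) :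
    SideFold z (x * z.2) (x' * z.2) := by
  refine ⟨(z.2, 0), by simp, ⟨x, x', hx, hx', by linarith, by simp⟩, ?_⟩
  have h : (x + x' : ℂ) = 1 := by exact_mod_cast h
  dsimp only
  linear_combination z.2 * h

theorem sideFold_three {x y : ℝ} (hx : 0 ≤ x) (hy : 0 ≤ y) (h : x + y = 1) :
    SideFold z (x * z.1 + y * z.2) (y * z.1 + x * z.2) := by
  refine ⟨(z.1, z.2), by simp, ⟨x, y, hx, hy, h, by simp⟩, ?_⟩
  have h : (x + y : ℂ) = 1 := by exact_mod_cast h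
  dsimp only
  linear_combination (z.1 + z.2) * h

theorem eqvGen_corner {w w' : ℂ} (hw : w = 0 ∨ w = z.1 ∨ w = z.2)
    (hw' : w' = 0 ∨ w' = z.1 ∨ w' = z.2) : Relation.EqvGen (SideFold z) w w' := by
  have key : ∀ w, (w = 0 ∨ w = z.1 ∨ w = z.2) → Relation.EqvGen (SideFold z) 0 w := by
    rintro w (rfl | rfl | rfl)
    · exact .refl _
    · exact .rel _ _ (by simpa using sideFold_one (z := z) (x := 0) (x' := 1) (by simp) (by simp))
    · exact .rel _ _ (by simpa using sideFold_two (z := z) (x := 0) (x' := 1) (by simp) (by simp))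
  exact (key w hw).symm.trans _ _ _ (key w' hw')

/-- A nonzero lattice translation can only carry one corner of the triangle to another, and the
corners are all identified by the folds. -/
theorem eqvGen_of_translate {x y x' y' : ℝ} {m n : ℤ} (hx : 0 ≤ x) (hy : 0 ≤ y) (hxy : x + y ≤ 1)
    (hx' : 0 ≤ x') (hy' : 0 ≤ y') (hxy' : x' + y' ≤ 1) (h1 : x' = x + m) (h2 : y' = y + n) :
    Relation.EqvGen (SideFold z) (x * z.1 + y * z.2) (x' * z.1 + y' * z.2) := by
  have hm1 : m ≤ 1 := by exact_mod_cast (by linarith : (m : ℝ) ≤ 1)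
  have hm2 : -1 ≤ m := by exact_mod_cast (by linarith : (-1 : ℝ) ≤ m)
  have hn1 : n ≤ 1 := by exact_mod_cast (by linarith : (n : ℝ) ≤ 1)
  have hn2 : -1 ≤ n := by exact_mod_cast (by linarith : (-1 : ℝ) ≤ n)
  have corner : ((x = 0 ∧ y = 0) ∨ (x = 1 ∧ y = 0) ∨ (x = 0 ∧ y = 1)) →
      ((x' = 0 ∧ y' = 0) ∨ (x' = 1 ∧ y' = 0) ∨ (x' = 0 ∧ y' = 1)) →
      Relation.EqvGen (SideFold z) (x * z.1 + y * z.2) (x' * z.1 + y' * z.2) := by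
    intro h h'
    refine eqvGen_corner ?_ ?_
    · rcases h with ⟨h, k⟩ | ⟨h, k⟩ | ⟨h, k⟩ <;> simp [h, k]
    · rcases h' with ⟨h, k⟩ | ⟨h, k⟩ | ⟨h, k⟩ <;> simp [h, k]
  interval_cases m <;> interval_cases n <;> norm_num at h1 h2
  · linarith
  · exact corner (Or.inr (Or.inl ⟨by linarith, by linarith⟩)) (Or.inl ⟨by linarith, by linarith⟩)
  · exact corner (Or.inr (Or.inl ⟨by linarith, by linarith⟩))
      (Or.inr (Or.inr ⟨by linarith, by linarith⟩))
  · exact corner (Or.inr (Or.inr ⟨by linarith, by linarith⟩)) (Or.inl ⟨by linarith, by linarith⟩)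
  · rw [h1, h2]
    exact .refl _
  · exact corner (Or.inl ⟨by linarith, by linarith⟩) (Or.inr (Or.inr ⟨by linarith, by linarith⟩))
  · exact corner (Or.inr (Or.inr ⟨by linarith, by linarith⟩))
      (Or.inr (Or.inl ⟨by linarith, by linarith⟩))
  · exact corner (Or.inl ⟨by linarith, by linarith⟩) (Or.inr (Or.inl ⟨by linarith, by linarith⟩))
  · linarith

/-- Here `m, n ≥ 0` and `m + n ≤ 2`. The values `(1,0)`, `(0,1)`, `(1,1)` are the half-turns about
the midpoints of the sides, that is, the folds; `(0,0)`, `(2,0)`, `(0,2)` fix a corner and meet the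
triangle only there. -/
theorem eqvGen_of_halfTurn {x y x' y' : ℝ} {m n : ℤ} (hx : 0 ≤ x) (hy : 0 ≤ y) (hxy : x + y ≤ 1)
    (hx' : 0 ≤ x') (hy' : 0 ≤ y') (hxy' : x' + y' ≤ 1) (h1 : x' = -x + m) (h2 : y' = -y + n) :
    Relation.EqvGen (SideFold z) (x * z.1 + y * z.2) (x' * z.1 + y' * z.2) := by
  have hm1 : 0 ≤ m := by exact_mod_cast (by linarith : (0 : ℝ) ≤ m)
  have hn1 : 0 ≤ n := by exact_mod_cast (by linarith : (0 : ℝ) ≤ n)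
  have hmn : m + n ≤ 2 := by exact_mod_cast (by linarith : (m + n : ℝ) ≤ 2)
  have hm2 : m ≤ 2 := by omega
  have hn2 : n ≤ 2 := by omega
  interval_cases m <;> interval_cases n <;> norm_num at h1 h2 hmn
  · rw [show x' = x by linarith, show y' = y by linarith]
    exact .refl _
  · rw [show x' = 0 by linarith, show x = 0 by linarith]
    simpa using Relation.EqvGen.rel _ _ (sideFold_two (z := z) hy hy' (by linarith))
  · rw [show x' = x by linarith, show y' = y by linarith]
    exact .refl _
  · rw [show y' = 0 by linarith, show y = 0 by linarith]
    simpa using Relation.EqvGen.rel _ _ (sideFold_one (z := z) hx hx' (by linarith))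
  · rw [show x' = y by linarith, show y' = x by linarith]
    exact .rel _ _ (sideFold_three hx hy (by linarith))
  · rw [show x' = x by linarith, show y' = y by linarith]
    exact .refl _

end

theorem re_comb (a b : GaussianInt) (x y : ℝ) :
    (x * (2 * a : ℂ) + y * (2 * b : ℂ)).re = 2 * (x * a.re + y * b.re) := by
  simp
  ring

theorem im_comb (a b : GaussianInt) (x y : ℝ) :
    (x * (2 * a : ℂ) + y * (2 * b : ℂ)).im = 2 * (x * a.im + y * b.im) := by
  simp
  ring

theorem exists_real_coords {a b : GaussianInt} (h : gaussDet a b ≠ 0) (w : ℂ) :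
    ∃ x y : ℝ, w = x * (2 * a : ℂ) + y * (2 * b : ℂ) := by
  have h' : (a.re * b.im - a.im * b.re : ℝ) ≠ 0 := by
    unfold gaussDet at h
    exact_mod_cast h
  have hk := mul_inv_cancel₀ h'
  set k := (a.re * b.im - a.im * b.re : ℝ)⁻¹
  refine ⟨(w.re * b.im - w.im * b.re) * k / 2, (a.re * w.im - a.im * w.re) * k / 2, ?_⟩
  apply Complex.ext
  · rw [re_comb]
    linear_combination (-w.re) * hk
  · rw [im_comb]
    linear_combination (-w.im) * hk

theorem real_coords_unique {a b : GaussianInt} (h : gaussDet a b ≠ 0) {x y x' y' : ℝ}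
    (he : x * (2 * a : ℂ) + y * (2 * b : ℂ) = x' * (2 * a : ℂ) + y' * (2 * b : ℂ)) :
    x = x' ∧ y = y' := by
  have h' : (a.re * b.im - a.im * b.re : ℝ) ≠ 0 := by
    unfold gaussDet at h
    exact_mod_cast h
  have e1 := congrArg Complex.re he
  have e2 := congrArg Complex.im he
  rw [re_comb, re_comb] at e1
  rw [im_comb, im_comb] at e2
  constructor
  · refine mul_right_cancel₀ h' ?_
    linear_combination (b.im / 2 : ℝ) * e1 - (b.re / 2 : ℝ) * e2
  · refine mul_right_cancel₀ h' ?_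
    linear_combination (a.re / 2 : ℝ) * e2 - (a.im / 2 : ℝ) * e1

theorem toComplex_comb (a b : GaussianInt) (m n : ℤ) :
    ((2 * (m * a + n * b) : GaussianInt) : ℂ) =
      ((m : ℝ) : ℂ) * (2 * a : ℂ) + ((n : ℝ) : ℂ) * (2 * b : ℂ) := by
  simp only [map_mul, map_add, map_intCast, map_ofNat]
  push_cast
  ring

theorem eqvGen_sideFold_iff {a b : GaussianInt} (h : gaussDet a b ≠ 0) {w w' : ℂ}
    (hw : w ∈ triangle (2 * (a : ℂ), 2 * (b : ℂ))) (hw' : w' ∈ triangle (2 * (a : ℂ), 2 * (b : ℂ))) :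
    Relation.EqvGen (SideFold (2 * (a : ℂ), 2 * (b : ℂ))) w w' ↔
      pillowSetoid (spanTwo a b) w w' := by
  constructor
  · intro hg
    clear hw hw'
    induction hg with
    | rel w w' hs =>
      obtain ⟨s, hs, -, rfl⟩ := hs
      rcases hs with rfl | rfl | rfl
      · exact ⟨2 * ((1 : ℤ) * a + (0 : ℤ) * b), ⟨_, _, rfl⟩,
          Or.inr (by rw [toComplex_comb]; push_cast; ring)⟩
      · exact ⟨2 * ((1 : ℤ) * a + (1 : ℤ) * b), ⟨_, _, rfl⟩,
          Or.inr (by rw [toComplex_comb]; push_cast; ring)⟩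
      · exact ⟨2 * ((0 : ℤ) * a + (1 : ℤ) * b), ⟨_, _, rfl⟩,
          Or.inr (by rw [toComplex_comb]; push_cast; ring)⟩
    | refl w => exact (pillowSetoid _).refl w
    | symm w w' _ ih => exact (pillowSetoid _).symm ih
    | trans w w' w'' _ _ h1 h2 => exact (pillowSetoid _).trans h1 h2
  · obtain ⟨x, y, hx, hy, hxy, rfl⟩ := mem_triangle.1 hw
    obtain ⟨x', y', hx', hy', hxy', rfl⟩ := mem_triangle.1 hw'
    rintro ⟨l, ⟨m, n, rfl⟩, he | he⟩
    · rw [toComplex_comb] at he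
      obtain ⟨e1, e2⟩ := real_coords_unique h (x := x') (y := y') (x' := x + m) (y' := y + n)
        (he.trans (by push_cast; ring))
      exact eqvGen_of_translate hx hy hxy hx' hy' hxy' e1 e2
    · rw [toComplex_comb] at he
      obtain ⟨e1, e2⟩ := real_coords_unique h (x := x') (y := y') (x' := -x + m) (y' := -y + n)
        (he.trans (by push_cast; ring))
      exact eqvGen_of_halfTurn hx hy hxy hx' hy' hxy' e1 e2

theorem exists_rel_mem_triangle {a b : GaussianInt} (h : gaussDet a b ≠ 0) (w : ℂ) :
    ∃ w' ∈ triangle (2 * (a : ℂ), 2 * (b : ℂ)), pillowSetoid (spanTwo a b) w w' := by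
  obtain ⟨x, y, rfl⟩ := exists_real_coords h w
  have ex := Int.floor_add_fract x
  have ey := Int.floor_add_fract y
  have hx0 := Int.fract_nonneg x
  have hy0 := Int.fract_nonneg y
  have hx1 := Int.fract_lt_one x
  have hy1 := Int.fract_lt_one y
  -- Translate into the period parallelogram; a point beyond the diagonal returns to the triangle by
  -- the half-turn about the centre.
  by_cases hxy : Int.fract x + Int.fract y ≤ 1
  · refine ⟨_, mem_triangle.2 ⟨Int.fract x, Int.fract y, hx0, hy0, hxy, rfl⟩,
      2 * ((-⌊x⌋ : ℤ) * a + (-⌊y⌋ : ℤ) * b), ⟨_, _, rfl⟩, Or.inl ?_⟩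
    rw [toComplex_comb]
    conv_rhs => rw [← ex, ← ey]
    push_cast
    simp
    ring
  · refine ⟨_, mem_triangle.2 ⟨1 - Int.fract x, 1 - Int.fract y, by linarith, by linarith,
      by linarith, rfl⟩, 2 * ((⌊x⌋ + 1 : ℤ) * a + (⌊y⌋ + 1 : ℤ) * b), ⟨_, _, rfl⟩, Or.inr ?_⟩
    rw [toComplex_comb, ← Int.self_sub_floor, ← Int.self_sub_floor]
    push_cast
    ring

/-! ### The folded triangle and the main theorem -/

theorem isFolding_pillow (a b : GaussianInt) (h : gaussDet a b ≠ 0) :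
    IsFolding (2 * (a : ℂ), 2 * (b : ℂ)) (pillow a b h).1 := by
  have := finite_quotient_spanTwo h
  have hL := isEvenLattice_spanTwo a b
  refine ⟨fun w => planeProj hL w, ?_, fun w w' => ?_, fun p => ?_⟩
  · intro x
    obtain ⟨w, rfl⟩ := planeProj_surjective hL x
    obtain ⟨w', hw', hr⟩ := exists_rel_mem_triangle h w
    exact ⟨⟨w', hw'⟩, (planeProj_eq_of_rel hL hr).symm⟩
  · rw [eqvGen_sideFold_iff h w.2 w'.2]
    exact planeProj_eq_iff hL
  · exact ⟨latticeDart hL p false, fun w u hwu => planeProj_eq hL hwu⟩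

theorem mainTheorem3 :
    ∃ Φ : MulAction.orbitRel.Quotient CutGlueGroup gaussLatticePos ≃ HGGauss224,
      ∀ (z : gaussLatticePos) (Q : SphereQuad224),
        Φ (Quotient.mk (MulAction.orbitRel CutGlueGroup gaussLatticePos) z) =
            Quotient.mk sphereQuadSetoid Q →
          IsFolding z Q.1 ∧ areaForm z z = (Nat.card Q.1.Face : ℂ) := by
  refine ⟨Equiv.ofBijective pillowClass pillowClass_bijective, fun z Q hQ => ?_⟩
  -- `Q` is an arbitrary representative; folding and the number of squares are both transported
  -- along this isomorphism.
  have hiso : Iso (pillowOf z).1 Q.1 := Quotient.exact hQ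
  have hpos := gaussDet_coord_pos z
  constructor
  · rw [eq_coord z]
    exact hiso.isFolding (isFolding_pillow _ _ hpos.ne')
  · rw [eq_coord z, areaForm_gauss, ← hiso.card_face, pillowOf, card_face_pillow]
    have : (2 * gaussDet (coordA z) (coordB z) : ℤ) =
        ((2 * (gaussDet (coordA z) (coordB z)).natAbs : ℕ) : ℤ) := by
      push_cast
      rw [abs_of_pos hpos]
    rw [this, Int.cast_natCast]
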